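/- Let $A$ be a separable (not necessarily unital) $C^*$-algebra. A completely positive (c.p.) map $\varphi : F \to A$ from a finite-dimensional $C^*$-algebra $F$ has strict order zero if $\varphi(e) \perp \varphi(e')$ (i.e. $\varphi(e)\varphi(e')=0$) for any two orthogonal minimal projections $e, e' \in F$. For an integer $n \ge 0$, a c.p. map $\varphi : M_{r_1} \oplus \cdots \oplus M_{r_s} \to A$ is $n$-decomposable if $\{1,\ldots,s\}$ is a disjoint union of (possibly empty) sets $I_0, \ldots, I_n$ such that the restriction of $\varphi$ to $\bigoplus_{i \in I_j} M_{r_i}$ has strict order zero for each $j$. The decomposition rank $\mathrm{dr}\, A$ is the least integer $n \ge 0$ such that, for all $b_1, \ldots, b_m \in A$ and $\varepsilon > 0$, there are $F = M_{r_1} \oplus \cdots \oplus M_{r_s}$ and c.p. contractions $\psi : A \to F$ and $\varphi : F \to A$ with $\|\varphi(\psi(b_k)) - b_k\| < \varepsilon$ for all $k$ and with $\varphi$ $n$-decomposable; $\mathrm{dr}\, A = \infty$ if there is no such $n$. Then $\mathrm{dr}\, A = 0$ if and only if $A$ is AF, that is, $A$ is the closure of the union of an increasing sequence of finite-dimensional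 $C^*$-subalgebras. -/

import Mathlib

open TopologicalSpace
open scoped CStarAlgebra ComplexOrder

/-- The finite-dimensional C⋆-algebra `⨁ i, M_{r i}(ℂ)`, with the C⋆-norm on each matrix algebra
and the maximum norm on the sum. -/
abbrev MatrixSum {ι : Type*} (r : ι → ℕ) : Type _ :=
  (i : ι) → CStarMatrix (Fin (r i)) (Fin (r i)) ℂ

/-- A minimal projection: a nonzero projection `p` such that the only projections below `p`
are `0` and `p`. -/
def IsMinimalProjection {F : Type*} [NonUnitalCStarAlgebra F] [PartialOrder F] (p : F) : Prop :=
  IsStarProjection p ∧ p ≠ 0 ∧ ∀ q : F, IsStarProjection q → q ≤ p → q = 0 ∨ q = p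

/-- Orthogonality `a ⊥ b` of elements of a C⋆-algebra. (For self-adjoint elements, each of the
four equations implies the others.) -/
def CStarOrthogonal {A : Type*} [NonUnitalCStarAlgebra A] (a b : A) : Prop :=
  a * b = 0 ∧ b * a = 0 ∧ star a * b = 0 ∧ a * star b = 0

section StrictOrder

variable {F A : Type*} [NonUnitalCStarAlgebra F] [PartialOrder F] [NonUnitalCStarAlgebra A]

/-- `ord φ ≤ n`: among the images under `φ` of any `n + 2` pairwise orthogonal minimal projections
of `F`, two are orthogonal. (Used for completely positive `φ` on a finite-dimensional `F`.) -/
def HasStrictOrderLE (φ : F →ₗ[ℂ] A) (n : ℕ) : Prop :=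
  ∀ e : Fin (n + 2) → F, (∀ i, IsMinimalProjection (e i)) →
    (∀ i j, i ≠ j → CStarOrthogonal (e i) (e j)) →
    ∃ i j, i ≠ j ∧ CStarOrthogonal (φ (e i)) (φ (e j))

/-- The strict order of `φ`: the least `n` with `HasStrictOrderLE φ n`, and `⊤` if there is none. -/
noncomputable def strictOrder (φ : F →ₗ[ℂ] A) : ℕ∞ :=
  ⨅ (n : ℕ) (_ : HasStrictOrderLE φ n), (n : ℕ∞)

end StrictOrder

/-- The inclusion of the partial sum `⨁ {i // p i}, M_{r i}` into `⨁ i, M_{r i}`, extending by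
zero in the remaining summands. -/
def MatrixSum.incl {ι : Type*} (r : ι → ℕ) (p : ι → Prop) [DecidablePred p] :
    MatrixSum (fun i : {i // p i} => r i) →ₗ[ℂ] MatrixSum r where
  toFun x i := if h : p i then x ⟨i, h⟩ else 0
  map_add' x y := by
    funext i
    by_cases h : p i <;> simp [h]
  map_smul' c x := by
    funext i
    by_cases h : p i <;> simp [h]

section DecompositionRank

variable {A : Type*} [NonUnitalCStarAlgebra A] [PartialOrder A] [StarOrderedRing A]

/-- A completely positive map `φ : M_{r 1} ⊕ ⋯ ⊕ M_{r s} → A` is `n`-decomposable if the index set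
is a disjoint union of (possibly empty) sets `I_0, …, I_n`, here the fibres of a map `c`, such that
the restriction of `φ` to `⨁ i ∈ I_j, M_{r i}` has strict order zero for each `j`. -/
def IsDecomposable {s : ℕ} {r : Fin s → ℕ} (φ : MatrixSum r →CP A) (n : ℕ) : Prop :=
  ∃ c : Fin s → Fin (n + 1), ∀ j : Fin (n + 1),
    strictOrder (φ.toLinearMap ∘ₗ MatrixSum.incl r (fun i => c i = j)) = 0

variable (A)

/-- `dr A ≤ n`: for all finite `S ⊆ A` and `ε > 0` there are a finite direct sum `F` of matrix
algebras and completely positive contractions `ψ : A → F` and `φ : F → A` such that `φ ∘ ψ` is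
within `ε` of the identity on `S` and `φ` is `n`-decomposable. -/
def HasDecompositionRankLE (n : ℕ) : Prop :=
  ∀ (S : Finset A) (ε : ℝ), 0 < ε →
    ∃ (s : ℕ) (r : Fin s → ℕ) (ψ : A →CP MatrixSum r) (φ : MatrixSum r →CP A),
      (∀ i, 0 < r i) ∧ (∀ a, ‖ψ a‖ ≤ ‖a‖) ∧ (∀ x, ‖φ x‖ ≤ ‖x‖) ∧
      (∀ b ∈ S, ‖φ (ψ b) - b‖ < ε) ∧ IsDecomposable φ n

/-- The decomposition rank of `A`: the least `n` with `HasDecompositionRankLE A n`, and `⊤` if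
there is none. -/
noncomputable def decompositionRank : ℕ∞ :=
  ⨅ (n : ℕ) (_ : HasDecompositionRankLE A n), (n : ℕ∞)

end DecompositionRank

/-- A C⋆-algebra is AF (approximately finite-dimensional) if it is the closure of the union of an
increasing sequence of finite-dimensional C⋆-subalgebras. (Finite-dimensional ⋆-subalgebras are
automatically closed; they need not contain a unit of `A`.) -/
def IsAFAlgebra (A : Type*) [NonUnitalCStarAlgebra A] : Prop :=
  ∃ B : ℕ → NonUnitalStarSubalgebra ℂ A, Monotone B ∧ (∀ n, FiniteDimensional ℂ (B n)) ∧
    Dense (⋃ n, (B n : Set A))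

/-! ### Completely positive maps of strict order zero -/

section OrderZero

/-! Rank zero means that the identity of `A` is approximated on finite sets by `φ ∘ ψ` with `φ`
itself of strict order zero, since there is only one colour.

From rank zero to AF. A c.p. map of strict order zero on a sum of matrix algebras satisfies `φ x * φ
y = φ 1 * φ (x * y)`, so it is multiplicative up to the factor `h = φ 1`, which commutes with its
image. It becomes a homomorphism wherever `h` can be inverted. Without a unit, this place is found
with two approximate units `e₀`, `e₁` satisfying `e₁ e₀ ≈ e₀`: for a spectral projection `q` of `ψ
e₀` away from `0`, the element `φ q` is almost a projection. Hence it has a quasi-inverse `k` in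
functional calculus, and `x ↦ k φ(x)` is a ⋆-homomorphism on `q F q`. Its image is a
finite-dimensional ⋆-subalgebra almost containing the given finite set
(`exists_finiteDimensional_of_orderZero_factorization`).

Such local approximation gives an increasing sequence by perturbing matrix units. If `B` is
finite-dimensional, its matrix units are close to exact matrix units in a finite-dimensional `C`
that approximates well enough. A unitary `u` of the unitization near `1` carries the former to the
latter, and `u⋆ C u` contains `B` while still approximating the given elements
(`exists_finiteDimensional_ge_approx`). Separability then allows exhausting a dense sequence.

From AF to rank zero. A finite-dimensional subalgebra has matrix units, hence a ⋆-homomorphism `φ`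
from a sum of matrix algebras onto it; homomorphisms preserve orthogonality. A c.p. contraction `ψ`
on all of `A` that is right inverse to `φ` on the subalgebra is obtained from positive functionals
normalized at the source projections: its entries are coefficients of left multiplication in the GNS
spaces. -/

theorem exists_star_mul_self_of_nonneg {A : Type*} [NonUnitalCStarAlgebra A] [PartialOrder A]
    [StarOrderedRing A] {a : A} (h : 0 ≤ a) : ∃ b, a = star b * b :=
  CStarAlgebra.nonneg_iff_eq_star_mul_self.mp h

/-- A Cauchy–Schwarz argument from 2-positivity. The Gram matrix of the row `(a, b)` has image `N⋆
N`; then `c φ(a⋆a) c⋆ = 0` is a sum of positive terms `(c N_k0⋆)(c N_k0⋆)⋆`, so every `c N_k0⋆`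
vanishes, and these are the left factors in `c φ(a⋆b)`. -/
theorem CompletelyPositiveMap.mul_map_star_mul_eq_zero {F A : Type*} [NonUnitalCStarAlgebra F]
    [PartialOrder F] [StarOrderedRing F] [NonUnitalCStarAlgebra A] [PartialOrder A]
    [StarOrderedRing A] (φ : F →CP A) {c : A} {a : F} (h : c * φ (star a * a) = 0) (b : F) :
    c * φ (star a * b) = 0 := by
  let w : Fin 2 → F := ![a, b]
  let R : CStarMatrix (Fin 2) (Fin 2) F :=
    CStarMatrix.ofMatrix fun i j => if i = 0 then w j else 0
  have hR : ∀ i j, (star R * R) i j = star (w i) * w j := fun i j => by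
    have hR' : ∀ i j, R i j = if i = 0 then w j else 0 := fun i j => rfl
    rw [CStarMatrix.mul_apply, Fin.sum_univ_two]
    simp [hR', CStarMatrix.star_apply]
  have hpos := φ.map_cstarMatrix_nonneg' 2 (star R * R) (star_mul_self_nonneg R)
  obtain ⟨N, hN⟩ := exists_star_mul_self_of_nonneg hpos
  have hent : ∀ i j, φ (star (w i) * w j) = ∑ k, star (N k i) * N k j := fun i j => by
    have h1 := congrFun (congrFun hN i) j
    rw [CStarMatrix.mul_apply, CStarMatrix.map_apply, hR] at h1
    simp only [CStarMatrix.star_apply] at h1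
    exact h1
  have h00 := hent 0 0
  have h01 := hent 0 1
  simp only [w, Matrix.cons_val_zero, Matrix.cons_val_one, Fin.sum_univ_two] at h00 h01
  have key : c * star (N 0 0) = 0 ∧ c * star (N 1 0) = 0 := by
    have h2 : (c * star (N 0 0)) * star (c * star (N 0 0)) +
        (c * star (N 1 0)) * star (c * star (N 1 0)) = 0 := by
      calc _ = c * φ (star a * a) * star c := by
            rw [h00]; simp only [star_mul, star_star]; noncomm_ring
        _ = 0 := by rw [h, zero_mul]
    have h3 := (add_eq_zero_iff_of_nonneg (mul_star_self_nonneg (c * star (N 0 0)))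
      (mul_star_self_nonneg (c * star (N 1 0)))).mp h2
    exact ⟨CStarRing.mul_star_self_eq_zero_iff _ |>.mp h3.1,
      CStarRing.mul_star_self_eq_zero_iff _ |>.mp h3.2⟩
  rw [h01, mul_add, ← mul_assoc, ← mul_assoc, key.1, key.2, zero_mul, zero_mul, add_zero]

theorem CompletelyPositiveMap.map_star {F A : Type*} [NonUnitalCStarAlgebra F]
    [PartialOrder F] [StarOrderedRing F] [NonUnitalCStarAlgebra A] [PartialOrder A]
    [StarOrderedRing A] (φ : F →CP A) (x : F) : φ (star x) = star (φ x) :=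
  StarHomClass.map_star φ x

/-- Both sides equal `φ(x p) φ(p y)`: the cross terms `φ(x p) φ((1 - p) y)` and `φ(x (1 - p)) φ(p
y)` vanish, by applying the previous vanishing principle on one side and, after taking adjoints, on
the other. This lets `p` move across the product. -/
theorem CompletelyPositiveMap.map_mul_mul_map {F A : Type*} [CStarAlgebra F]
    [PartialOrder F] [StarOrderedRing F] [NonUnitalCStarAlgebra A] [PartialOrder A]
    [StarOrderedRing A] (φ : F →CP A) {p : F} (hp : IsStarProjection p)
    (h : φ p * φ (1 - p) = 0) (x y : F) : φ (x * p) * φ y = φ x * φ (p * y) := by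
  have zero : ∀ {p : F}, IsStarProjection p → φ p * φ (1 - p) = 0 → ∀ x y,
      φ (x * p) * φ ((1 - p) * y) = 0 := by
    intro p hp h x y
    have hs : star p = p := hp.isSelfAdjoint
    have hs' : star (1 - p) = 1 - p := by rw [star_sub, star_one, hs]
    have hi : p * p = p := hp.isIdempotentElem
    have hi' : (1 - p) * (1 - p) = 1 - p := hp.one_sub.isIdempotentElem
    have h1 : φ p * φ ((1 - p) * y) = 0 := by
      have := φ.mul_map_star_mul_eq_zero (c := φ p) (a := 1 - p) (by rw [hs', hi', h]) y
      rwa [hs'] at this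
    have h2 : φ (star y * (1 - p)) * φ p = 0 := by
      have := congrArg star h1
      rwa [star_mul, ← φ.map_star, ← φ.map_star, star_mul, hs, hs', star_zero] at this
    have h3 : φ (star y * (1 - p)) * φ (p * star x) = 0 := by
      have := φ.mul_map_star_mul_eq_zero (c := φ (star y * (1 - p))) (a := p)
        (by rw [hs, hi, h2]) (star x)
      rwa [hs] at this
    have := congrArg star h3
    rwa [star_mul, ← φ.map_star, ← φ.map_star, star_mul, star_mul, hs, hs', star_star, star_star,
      star_zero] at this
  have h' : φ (1 - p) * φ (1 - (1 - p)) = 0 := by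
    have := congrArg star h
    rw [star_mul, ← φ.map_star, ← φ.map_star, star_sub, star_one, hp.isSelfAdjoint.star_eq,
      star_zero] at this
    rwa [sub_sub_cancel]
  have e1 := zero hp h x y
  have e2 := zero hp.one_sub h' x y
  rw [sub_sub_cancel] at e2
  rw [sub_mul, one_mul, map_sub, mul_sub, sub_eq_zero] at e1
  rw [mul_sub, mul_one, map_sub, sub_mul, sub_eq_zero] at e2
  rw [e1, e2]

theorem isMinimalProjection_of_forall_mul_mul {F : Type*} [NonUnitalCStarAlgebra F]
    [PartialOrder F] [StarOrderedRing F] {p : F} (hp : IsStarProjection p) (h0 : p ≠ 0)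
    (h : ∀ x : F, ∃ c : ℂ, p * x * p = c • p) : IsMinimalProjection p := by
  refine ⟨hp, h0, fun q hq hqp => ?_⟩
  have h1 : p * q = q := (hq.le_iff_mul_eq_right hp).mp hqp
  have h2 : q * p = q := (hq.le_iff_mul_eq_left hp).mp hqp
  obtain ⟨c, hc⟩ := h q
  rw [h1, h2] at hc
  by_cases hc0 : c = 0
  · left; rw [hc, hc0, zero_smul]
  · right
    have h3 : q * q = c • q := by nth_rw 1 [hc]; rw [smul_mul_assoc, h1]
    rw [hq.isIdempotentElem.eq] at h3
    have h4 : c • q = c • p := by rw [← h3, hc]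
    exact smul_right_injective F hc0 h4

/-! ### Rank-one operators in a sum of matrix algebras -/

namespace MatrixSum

variable {ι : Type*} [DecidableEq ι] {r : ι → ℕ}

/-- The operator `v w⋆` in the `i`-th summand of `⨁ i, M_{r i}`. -/
def ketBra (i : ι) (v w : Fin (r i) → ℂ) : MatrixSum r :=
  Pi.single i (CStarMatrix.ofMatrix (Matrix.vecMulVec v (star w)))

theorem ketBra_apply_self (i : ι) (v w : Fin (r i) → ℂ) :
    ketBra (r := r) i v w i = CStarMatrix.ofMatrix (Matrix.vecMulVec v (star w)) :=
  Pi.single_eq_same _ _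

theorem ketBra_apply_of_ne {i j : ι} (h : j ≠ i) (v w : Fin (r i) → ℂ) :
    ketBra (r := r) i v w j = 0 :=
  Pi.single_eq_of_ne h _

theorem ketBra_ext {i : ι} {v w : Fin (r i) → ℂ} {x : MatrixSum r}
    (h : ∀ k l, x i k l = v k * star (w l)) (h' : ∀ j, j ≠ i → x j = 0) :
    x = ketBra i v w := by
  funext j
  by_cases hj : j = i
  · subst hj
    rw [ketBra_apply_self]
    ext k l
    rw [h]; rfl
  · rw [h' j hj, ketBra_apply_of_ne hj]

theorem ketBra_apply_self_apply (i : ι) (v w : Fin (r i) → ℂ) (k l : Fin (r i)) :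
    ketBra (r := r) i v w i k l = v k * star (w l) := by
  rw [ketBra_apply_self]; rfl

theorem ketBra_add_left (i : ι) (u v w : Fin (r i) → ℂ) :
    ketBra (r := r) i (u + v) w = ketBra i u w + ketBra i v w := by
  refine (ketBra_ext (fun k l => ?_) fun j hj => ?_).symm
  · rw [Pi.add_apply, CStarMatrix.add_apply, ketBra_apply_self_apply, ketBra_apply_self_apply,
      Pi.add_apply, add_mul]
  · rw [Pi.add_apply, ketBra_apply_of_ne hj, ketBra_apply_of_ne hj, add_zero]

theorem star_ketBra (i : ι) (v w : Fin (r i) → ℂ) :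
    star (ketBra (r := r) i v w) = ketBra i w v := by
  refine ketBra_ext (fun k l => ?_) fun j hj => ?_
  · rw [Pi.star_apply, CStarMatrix.star_apply, ketBra_apply_self_apply, star_mul, star_star]
  · rw [Pi.star_apply, ketBra_apply_of_ne hj, star_zero]

theorem ketBra_add_right (i : ι) (u v w : Fin (r i) → ℂ) :
    ketBra (r := r) i u (v + w) = ketBra i u v + ketBra i u w := by
  rw [← star_ketBra, ketBra_add_left, star_add, star_ketBra, star_ketBra]

theorem ketBra_smul_left (i : ι) (c : ℂ) (v w : Fin (r i) → ℂ) :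
    ketBra (r := r) i (c • v) w = c • ketBra i v w := by
  refine (ketBra_ext (fun k l => ?_) fun j hj => ?_).symm
  · rw [Pi.smul_apply, CStarMatrix.smul_apply, ketBra_apply_self_apply, Pi.smul_apply,
      smul_eq_mul, smul_eq_mul, mul_assoc]
  · rw [Pi.smul_apply, ketBra_apply_of_ne hj, smul_zero]

theorem ketBra_smul_right (i : ι) (c : ℂ) (v w : Fin (r i) → ℂ) :
    ketBra (r := r) i v (c • w) = star c • ketBra i v w := by
  rw [← star_ketBra, ketBra_smul_left, star_smul, star_ketBra]

theorem mul_ketBra (x : MatrixSum r) (i : ι) (v w : Fin (r i) → ℂ) :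
    x * ketBra i v w = ketBra i (fun k => ∑ l, x i k l * v l) w := by
  refine ketBra_ext (fun k l => ?_) fun j hj => ?_
  · rw [Pi.mul_apply, CStarMatrix.mul_apply, Finset.sum_mul]
    exact Finset.sum_congr rfl fun m _ => by rw [ketBra_apply_self_apply, mul_assoc]
  · rw [Pi.mul_apply, ketBra_apply_of_ne hj, mul_zero]

theorem ketBra_mul_ketBra (i : ι) (u v w z : Fin (r i) → ℂ) :
    ketBra (r := r) i u v * ketBra i w z = (star v ⬝ᵥ w) • ketBra i u z := by
  rw [mul_ketBra, ← ketBra_smul_left]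
  congr 1
  funext k
  rw [Pi.smul_apply, smul_eq_mul, dotProduct, Finset.sum_mul]
  refine Finset.sum_congr rfl fun l _ => ?_
  rw [ketBra_apply_self_apply, Pi.star_apply]; ring

theorem ketBra_mul_ketBra_of_ne {i j : ι} (h : i ≠ j) (u v : Fin (r i) → ℂ)
    (w z : Fin (r j) → ℂ) : ketBra (r := r) i u v * ketBra j w z = 0 := by
  rw [mul_ketBra, ketBra_apply_of_ne h.symm]
  symm
  exact ketBra_ext (fun k l => by simp) fun j hj => rfl

theorem eq_sum_ketBra [Fintype ι] (x : MatrixSum r) :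
    x = ∑ i, ∑ k, ∑ l, x i k l • ketBra i (Pi.single k 1) (Pi.single l 1) := by
  funext j
  ext k l
  rw [Finset.sum_apply, Finset.sum_eq_single j]
  · have : ∀ (f : Fin (r j) → Fin (r j) → MatrixSum r), (∑ m, ∑ n, f m n) j k l =
        ∑ m, ∑ n, f m n j k l := fun f => by
      simp only [Finset.sum_apply]
      exact (Matrix.sum_apply _ _ _ _).trans <| Finset.sum_congr rfl fun m _ =>
        Matrix.sum_apply _ _ _ _
    rw [this, Finset.sum_eq_single k, Finset.sum_eq_single l]
    · rw [Pi.smul_apply, CStarMatrix.smul_apply, ketBra_apply_self_apply]; simp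
    · intro n _ hn
      rw [Pi.smul_apply, CStarMatrix.smul_apply, ketBra_apply_self_apply]; simp [hn.symm]
    · simp
    · intro n _ hn
      refine Finset.sum_eq_zero fun m _ => ?_
      rw [Pi.smul_apply, CStarMatrix.smul_apply, ketBra_apply_self_apply]; simp [hn.symm]
    · simp
  · intro i _ hi
    rw [Finset.sum_apply]
    refine Finset.sum_eq_zero fun m _ => ?_
    rw [Finset.sum_apply]
    refine Finset.sum_eq_zero fun n _ => ?_
    rw [Pi.smul_apply, ketBra_apply_of_ne hi.symm, smul_zero]
  · simp

theorem one_eq_sum_ketBra [Fintype ι] :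
    (1 : MatrixSum r) = ∑ i, ∑ k, ketBra i (Pi.single k 1) (Pi.single k 1) := by
  conv_lhs => rw [eq_sum_ketBra (1 : MatrixSum r)]
  refine Finset.sum_congr rfl fun i _ => Finset.sum_congr rfl fun k _ => ?_
  rw [Finset.sum_eq_single k]
  · rw [Pi.one_apply, CStarMatrix.one_apply_eq, one_smul]
  · intro l _ hl
    rw [Pi.one_apply, CStarMatrix.one_apply_ne hl.symm, zero_smul]
  · simp

theorem ketBra_isStarProjection {i : ι} {v : Fin (r i) → ℂ} (hv : star v ⬝ᵥ v = 1) :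
    IsStarProjection (ketBra (r := r) i v v) :=
  ⟨by rw [IsIdempotentElem, ketBra_mul_ketBra, hv, one_smul], star_ketBra i v v⟩

theorem ketBra_isMinimalProjection [Fintype ι] {i : ι} {v : Fin (r i) → ℂ} (hv : star v ⬝ᵥ v = 1) :
    IsMinimalProjection (ketBra (r := r) i v v) := by
  refine isMinimalProjection_of_forall_mul_mul (ketBra_isStarProjection hv) (fun h => ?_)
    fun x => ⟨star v ⬝ᵥ fun k => ∑ l, x i k l * v l, ?_⟩
  · have h1 : ∀ k, v k = 0 := fun k => by
      have := ketBra_apply_self_apply (r := r) i v v k k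
      rw [h] at this
      simpa using this.symm
    rw [funext h1] at hv
    simp [dotProduct] at hv
  · rw [mul_assoc, mul_ketBra, ketBra_mul_ketBra]

theorem cstarOrthogonal_ketBra [Fintype ι] {i : ι} {v w : Fin (r i) → ℂ} (h : star v ⬝ᵥ w = 0)
    (h' : star w ⬝ᵥ v = 0) :
    CStarOrthogonal (A := MatrixSum r) (ketBra i v v) (ketBra i w w) := by
  simp [CStarOrthogonal, star_ketBra, ketBra_mul_ketBra, h, h']

theorem cstarOrthogonal_ketBra_of_ne [Fintype ι] {i j : ι} (hij : i ≠ j) (v : Fin (r i) → ℂ)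
    (w : Fin (r j) → ℂ) :
    CStarOrthogonal (A := MatrixSum r) (ketBra i v v) (ketBra j w w) := by
  simp [CStarOrthogonal, star_ketBra, ketBra_mul_ketBra_of_ne hij, ketBra_mul_ketBra_of_ne hij.symm]

end MatrixSum

end OrderZero

/-! ### Strict order zero implies multiplicativity up to `φ 1` -/

section OrderZeroMatrixSum

theorem HasStrictOrderLE.map_mul_map_eq_zero {F A : Type*} [NonUnitalCStarAlgebra A]
    [NonUnitalCStarAlgebra F] [PartialOrder F]
    {φ : F →ₗ[ℂ] A} (h : HasStrictOrderLE φ 0) {p q : F} (hp : IsMinimalProjection p)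
    (hq : IsMinimalProjection q) (hpq : CStarOrthogonal p q) : φ p * φ q = 0 := by
  have hqp : CStarOrthogonal q p := by
    obtain ⟨h1, h2, h3, h4⟩ := hpq
    exact ⟨h2, h1, by simpa using congrArg star h3, by simpa using congrArg star h4⟩
  obtain ⟨i, j, hij, ho⟩ := h ![p, q] (fun i => by fin_cases i <;> assumption) (fun i j hij => by
    fin_cases i <;> fin_cases j <;> first | exact absurd rfl hij | assumption)
  fin_cases i <;> fin_cases j <;>
    first | exact absurd rfl hij | exact ho.1 | exact ho.2.1

/-- A completely positive map of strict order zero on a sum of matrix algebras is a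
homomorphism up to the multiplier `φ 1`. -/
theorem MatrixSum.map_mul_map_of_hasStrictOrderLE_zero {s : ℕ} {r : Fin s → ℕ} {A : Type*}
    [NonUnitalCStarAlgebra A] [PartialOrder A] [StarOrderedRing A] (φ : MatrixSum r →CP A)
    (h : HasStrictOrderLE φ.toLinearMap 0) (x y : MatrixSum r) : φ x * φ y = φ 1 * φ (x * y) := by
  have orth : ∀ {p q : MatrixSum r}, IsMinimalProjection p → IsMinimalProjection q →
      CStarOrthogonal p q → φ p * φ q = 0 := fun hp hq hpq => h.map_mul_map_eq_zero hp hq hpq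
  -- The elements that can be moved across the product form a subspace closed under multiplication.
  -- It suffices to find all matrix units in it; the claim is then the case of moving `x` away from
  -- `1 * x`.
  let Z : MatrixSum r → Prop := fun z => ∀ x y, φ (x * z) * φ y = φ x * φ (z * y)
  have Zmul : ∀ {z w}, Z z → Z w → Z (z * w) := fun {z w} hz hw x y => by
    rw [← mul_assoc, hw, hz, mul_assoc]
  have Zadd : ∀ {z w}, Z z → Z w → Z (z + w) := fun {z w} hz hw x y => by
    rw [mul_add, add_mul, map_add, map_add, add_mul, mul_add, hz, hw]
  have Zsmul : ∀ {z} (c : ℂ), Z z → Z (c • z) := fun {z} c hz x y => by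
    rw [mul_smul_comm, smul_mul_assoc, map_smul, map_smul, smul_mul_assoc, mul_smul_comm, hz]
  have Zsum : ∀ {κ : Type} (t : Finset κ) (f : κ → MatrixSum r), (∀ k ∈ t, Z (f k)) →
      Z (∑ k ∈ t, f k) := fun {κ} t f hf => by
    classical
    induction t using Finset.induction_on with
    | empty => intro x y; simp
    | insert a t ha ih =>
      rw [Finset.sum_insert ha]
      exact Zadd (hf a (Finset.mem_insert_self a t))
        (ih fun k hk => hf k (Finset.mem_insert_of_mem hk))
  let e : ∀ i, Fin (r i) → Fin (r i) → ℂ := fun i k => Pi.single k 1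
  have ee : ∀ i k l, star (e i k) ⬝ᵥ e i l = if k = l then 1 else 0 := fun i k l => by
    simp only [e, dotProduct_single, mul_one, Pi.star_apply, Pi.single_apply, apply_ite star,
      star_one, star_zero]
    simp [eq_comm]
  have mine : ∀ i k, IsMinimalProjection (ketBra (r := r) i (e i k) (e i k)) := fun i k =>
    ketBra_isMinimalProjection (by rw [ee, if_pos rfl])
  have Zdiag : ∀ i k, Z (ketBra i (e i k) (e i k)) := fun i k => by
    refine φ.map_mul_mul_map (mine i k).1 ?_
    have : (1 : MatrixSum r) - ketBra i (e i k) (e i k) =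
        ∑ j ∈ Finset.univ.erase i, ∑ m, ketBra j (e j m) (e j m) +
          ∑ m ∈ Finset.univ.erase k, ketBra i (e i m) (e i m) := by
      rw [sub_eq_iff_eq_add, add_assoc, Finset.sum_erase_add _ _ (Finset.mem_univ _),
        Finset.sum_erase_add _ _ (Finset.mem_univ _)]
      exact one_eq_sum_ketBra
    rw [this, map_add, map_sum, map_sum, mul_add, Finset.mul_sum, Finset.mul_sum,
      Finset.sum_eq_zero, Finset.sum_eq_zero, add_zero]
    · intro m hm
      have hm' := Finset.ne_of_mem_erase hm
      exact orth (mine _ _) (mine _ _) (cstarOrthogonal_ketBra (by rw [ee, if_neg hm'.symm])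
        (by rw [ee, if_neg hm']))
    · intro j hj
      rw [map_sum, Finset.mul_sum]
      exact Finset.sum_eq_zero fun m _ => orth (mine _ _) (mine _ _)
        (cstarOrthogonal_ketBra_of_ne (Finset.ne_of_mem_erase hj).symm _ _)
  have Zoff : ∀ i k l, k ≠ l → Z (ketBra i (e i k) (e i l)) := fun i k l hkl => by
    obtain ⟨c, hc, hc'⟩ : ∃ c : ℂ, c * c = 1 / 2 ∧ star c = c :=
      ⟨((Real.sqrt 2 : ℝ) : ℂ)⁻¹, by
        rw [← mul_inv, ← Complex.ofReal_mul, Real.mul_self_sqrt (by norm_num)]; norm_num, by simp⟩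
    let u : Fin (r i) → ℂ := c • (e i k + e i l)
    -- With `c = 1/√2`, the vectors `u`, `v` are another orthonormal basis of the span of `e i k`,
    -- `e i l`. So `1 - u u⋆` is again a sum of minimal projections orthogonal to `u u⋆`.
    let v : Fin (r i) → ℂ := c • (e i k + (-1 : ℂ) • e i l)
    have eu : ∀ m, star (e i m) ⬝ᵥ u = c * ((if m = k then 1 else 0) + if m = l then 1 else 0) :=
      fun m => by simp only [u, dotProduct_smul, dotProduct_add, ee, smul_eq_mul]
    have ev : ∀ m, star (e i m) ⬝ᵥ v =
        c * ((if m = k then 1 else 0) + (-1) * if m = l then 1 else 0) :=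
      fun m => by simp only [v, dotProduct_smul, dotProduct_add, ee, smul_eq_mul]
    have hu : star u = c • (star (e i k) + star (e i l)) := by
      simp only [u, star_smul, star_add, hc']
    have hv : star v = c • (star (e i k) + (-1 : ℂ) • star (e i l)) := by
      simp only [v, star_smul, star_add, hc', star_neg, star_one]
    have ue : ∀ m, star u ⬝ᵥ e i m = c * ((if k = m then 1 else 0) + if l = m then 1 else 0) :=
      fun m => by simp only [hu, smul_dotProduct, add_dotProduct, ee, smul_eq_mul]
    have uu : star u ⬝ᵥ u = 1 := by
      rw [hu, smul_dotProduct, add_dotProduct, eu, eu, if_pos rfl, if_neg hkl, if_neg hkl.symm,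
        if_pos rfl, smul_eq_mul]
      linear_combination 2 * hc
    have uv : star u ⬝ᵥ v = 0 := by
      rw [hu, smul_dotProduct, add_dotProduct, ev, ev, if_pos rfl, if_neg hkl, if_neg hkl.symm,
        if_pos rfl, smul_eq_mul]
      ring
    have vu : star v ⬝ᵥ u = 0 := by
      rw [hv, smul_dotProduct, add_dotProduct, smul_dotProduct, eu, eu, if_pos rfl, if_neg hkl,
        if_neg hkl.symm, if_pos rfl, smul_eq_mul, smul_eq_mul]
      ring
    have vv : star v ⬝ᵥ v = 1 := by
      rw [hv, smul_dotProduct, add_dotProduct, smul_dotProduct, ev, ev, if_pos rfl, if_neg hkl,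
        if_neg hkl.symm, if_pos rfl, smul_eq_mul, smul_eq_mul]
      linear_combination 2 * hc
    have huu : ketBra (r := r) i u u + ketBra i v v =
        ketBra i (e i k) (e i k) + ketBra i (e i l) (e i l) := by
      simp only [u, v, ketBra_smul_left, ketBra_smul_right, ketBra_add_left, ketBra_add_right,
        hc', star_neg, star_one]
      match_scalars <;> first | ring1 | linear_combination 2 * hc
    have Zu : Z (ketBra i u u) := by
      refine φ.map_mul_mul_map (ketBra_isStarProjection uu) ?_
      have : (1 : MatrixSum r) - ketBra i u u =
          ∑ j ∈ Finset.univ.erase i, ∑ m, ketBra j (e j m) (e j m) +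
            (∑ m ∈ (Finset.univ.erase k).erase l, ketBra i (e i m) (e i m) + ketBra i v v) := by
        rw [sub_eq_iff_eq_add, add_assoc, add_assoc, add_comm (ketBra i v v), huu,
          add_comm (ketBra i (e i k) (e i k)),
          ← add_assoc _ (ketBra i (e i l) (e i l)),
          Finset.sum_erase_add _ _ (Finset.mem_erase.mpr ⟨hkl.symm, Finset.mem_univ _⟩),
          Finset.sum_erase_add _ _ (Finset.mem_univ _),
          Finset.sum_erase_add _ _ (Finset.mem_univ _)]
        exact one_eq_sum_ketBra
      have minu := ketBra_isMinimalProjection (r := r) uu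
      rw [this, map_add, map_add, map_sum, map_sum, mul_add, mul_add, Finset.mul_sum,
        Finset.mul_sum, Finset.sum_eq_zero, Finset.sum_eq_zero, zero_add, zero_add]
      · exact orth minu (ketBra_isMinimalProjection vv) (cstarOrthogonal_ketBra uv vu)
      · intro m hm
        have hm1 := Finset.ne_of_mem_erase hm
        have hm2 := Finset.ne_of_mem_erase (Finset.mem_of_mem_erase hm)
        exact orth minu (mine _ _) (cstarOrthogonal_ketBra
          (by rw [ue, if_neg hm1.symm, if_neg hm2.symm]; simp)
          (by rw [eu, if_neg hm1, if_neg hm2]; simp))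
      · intro j hj
        rw [map_sum, Finset.mul_sum]
        exact Finset.sum_eq_zero fun m _ => orth minu (mine _ _)
          (cstarOrthogonal_ketBra_of_ne (Finset.ne_of_mem_erase hj).symm _ _)
    -- An off-diagonal unit comes from two projections: `(e_k e_k⋆)(u u⋆) = (e_k e_k⋆ + e_k e_l⋆) /
    -- 2`.
    have h1 : ketBra (r := r) i (e i k) (e i l) = (2 : ℂ) • (ketBra i (e i k) (e i k) *
        ketBra i u u) + (-1 : ℂ) • ketBra i (e i k) (e i k) := by
      rw [ketBra_mul_ketBra, eu, if_pos rfl, if_neg hkl]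
      simp only [u, ketBra_smul_right, ketBra_add_right, hc', smul_smul, add_zero, mul_one]
      match_scalars <;> first | ring1 | linear_combination 2 * hc | linear_combination -2 * hc
    rw [h1]
    exact Zadd (Zsmul _ (Zmul (Zdiag i k) Zu)) (Zsmul _ (Zdiag i k))
  have hZ : ∀ z, Z z := fun z => by
    rw [eq_sum_ketBra z]
    refine Zsum _ _ fun i _ => Zsum _ _ fun k _ => Zsum _ _ fun l _ => Zsmul _ ?_
    by_cases hkl : k = l
    · subst hkl; exact Zdiag i k
    · exact Zoff i k l hkl
  simpa using hZ x 1 y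

end OrderZeroMatrixSum

/-! ### Local approximation by finite-dimensional subalgebras -/

section LocalApproximation

/-- The elements `p(a) a` lie in the finite-dimensional `B`, so some nonzero `p` has `p(a) a = 0`,
and the spectrum consists of roots of `p X`. The extra factor `X` is what keeps the values in the
possibly nonunital `B`. -/
theorem quasispectrum_finite_of_mem_of_finiteDimensional {A : Type*} [NonUnitalCStarAlgebra A]
    (B : NonUnitalStarSubalgebra ℂ A) [FiniteDimensional ℂ B] {a : A} (ha : a ∈ B) :
    (quasispectrum ℝ a).Finite := by
  let x : Unitization ℂ A := (a : Unitization ℂ A)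
  let V : Submodule ℂ (Unitization ℂ A) :=
    B.toSubmodule.map (Unitization.inrHom ℂ ℂ A)
  have hVf : FiniteDimensional ℂ B.toSubmodule := ‹FiniteDimensional ℂ B›
  have hV : FiniteDimensional ℂ V := inferInstance
  let ev : Polynomial ℂ →ₗ[ℂ] Unitization ℂ A :=
    LinearMap.mulRight ℂ x ∘ₗ (Polynomial.aeval x).toLinearMap
  have hmem : ∀ p, ev p ∈ V := by
    intro p
    induction p using Polynomial.induction_on' with
    | add p q hp hq => rw [map_add]; exact V.add_mem hp hq
    | monomial n c =>
      have hpow : ∀ n : ℕ, x ^ n * x ∈ V := by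
        intro n
        induction n with
        | zero => rw [pow_zero, one_mul]; exact ⟨a, ha, rfl⟩
        | succ n ih =>
          obtain ⟨b, hb, hbx⟩ := ih
          refine ⟨a * b, B.mul_mem ha hb, ?_⟩
          rw [pow_succ', mul_assoc, ← hbx]
          exact Unitization.inr_mul ℂ a b
      have : ev (Polynomial.monomial n c) = c • (x ^ n * x) := by
        simp [ev, Polynomial.aeval_monomial, Algebra.algebraMap_eq_smul_one]
      rw [this]
      exact V.smul_mem c (hpow n)
  have hninj : ¬ Function.Injective (ev.codRestrict V hmem) := fun hinj =>
    Polynomial.not_finite (R := ℂ) (Module.Finite.of_injective _ hinj)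
  obtain ⟨p, hp, hp0⟩ : ∃ p, ev p = 0 ∧ p ≠ 0 := by
    rw [← LinearMap.ker_eq_bot, Submodule.eq_bot_iff] at hninj
    push Not at hninj
    obtain ⟨p, hp, hp0⟩ := hninj
    exact ⟨p, by simpa using congrArg Subtype.val (LinearMap.mem_ker.mp hp), hp0⟩
  have hq : Polynomial.aeval x (p * Polynomial.X) = 0 := by
    simpa [ev] using hp
  have hq0 : p * Polynomial.X ≠ 0 := mul_ne_zero hp0 Polynomial.X_ne_zero
  have hfin : (quasispectrum ℂ a).Finite := by
    rw [Unitization.quasispectrum_eq_spectrum_inr' ℂ ℂ a]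
    refine (Polynomial.finite_setOfPred_isRoot hq0).subset fun t ht => ?_
    have h1 := spectrum.subset_polynomial_aeval x (p * Polynomial.X) ⟨t, ht, rfl⟩
    rw [hq, spectrum.zero_eq] at h1
    exact h1
  rw [← quasispectrum.preimage_algebraMap ℂ]
  exact hfin.preimage (FaithfulSMul.algebraMap_injective ℝ ℂ).injOn

/-- A spectral projection of a selfadjoint element of a finite-dimensional C⋆-algebra. -/
theorem exists_isStarProjection_cutoff {F : Type*} [NonUnitalCStarAlgebra F] [PartialOrder F]
    [StarOrderedRing F] [FiniteDimensional ℂ F] {x : F} (hx : IsSelfAdjoint x) {η : ℝ}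
    (hη : 0 < η) : ∃ q : F, IsStarProjection q ∧ Commute q x ∧ (η ^ 2) • q ≤ x * x ∧
      ‖x - q * x‖ ≤ η := by
  have hfd : FiniteDimensional ℂ (⊤ : NonUnitalStarSubalgebra ℂ F) :=
    inferInstanceAs (FiniteDimensional ℂ (⊤ : Submodule ℂ F))
  have hfin := quasispectrum_finite_of_mem_of_finiteDimensional ⊤
    (NonUnitalStarAlgebra.mem_top (R := ℂ) (x := x))
  -- On a finite quasispectrum every function is continuous, so indicator functions are admissible
  -- in the functional calculus.
  have cont : ∀ f : ℝ → ℝ, ContinuousOn f (quasispectrum ℝ x) := fun f =>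
    hfin.continuousOn f
  let f : ℝ → ℝ := fun t => if η ≤ |t| then 1 else 0
  have f0 : f 0 = 0 := if_neg (by simpa using hη)
  have hqx : cfcₙ f x * x = cfcₙ (fun t : ℝ => f t * t) x := by
    conv_lhs => rw [← cfcₙ_id ℝ x, cfcₙ_id ℝ x]
    nth_rw 2 [← cfcₙ_id ℝ x]
    exact (cfcₙ_mul f id x (cont _) f0 (cont _) rfl).symm
  have hxx : x * x = cfcₙ (fun t : ℝ => t * t) x := by
    nth_rw 1 2 [← cfcₙ_id ℝ x]
    exact (cfcₙ_mul id id x (cont _) rfl (cont _) rfl).symm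
  refine ⟨cfcₙ f x, ⟨?_, cfcₙ_predicate f x⟩, (Commute.refl x).cfcₙ_real f, ?_, ?_⟩
  · rw [IsIdempotentElem, ← cfcₙ_mul f f x (cont _) f0 (cont _) f0]
    congr 1
    funext t
    by_cases ht : η ≤ |t| <;> simp [f, ht]
  · rw [hxx, ← cfcₙ_smul (η ^ 2) f x (cont _) f0]
    refine cfcₙ_mono (fun t _ => ?_) (cont _) (cont _) (by simp [f0]) (by simp)
    by_cases ht : η ≤ |t|
    · simp only [f, if_pos ht, smul_eq_mul, mul_one]
      rw [← pow_two, ← sq_abs t]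
      gcongr
    · simp only [f, if_neg ht, smul_eq_mul, mul_zero]
      exact mul_self_nonneg t
  · rw [hqx]
    nth_rw 1 [← cfcₙ_id ℝ x]
    rw [← cfcₙ_sub id (fun t => f t * t) x (cont _) rfl (cont _) (by simp)]
    refine norm_cfcₙ_le fun t _ => ?_
    by_cases ht : η ≤ |t|
    · simp [f, ht, hη.le]
    · simp only [f, ht, id, if_false, zero_mul, sub_zero, Real.norm_eq_abs]
      exact (not_le.mp ht).le

/-- A globally continuous inverse for elements whose spectrum misses `[1/4, 3/4]`. -/
theorem exists_continuous_cutoff_inv : ∃ m : ℝ → ℝ, Continuous m ∧ m 0 = 0 ∧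
    (∀ t, t < 1 / 4 → m t = 0) ∧ ∀ t, 3 / 4 < t → m t = 1 / t := by
  have h0 : ∀ t : ℝ, t < 1 / 4 →
      max 0 (min 1 (2 * t - 1 / 2)) / max t (3 / 4) = 0 := fun t ht => by
    rw [max_eq_left ((min_le_right _ _).trans (by linarith)), zero_div]
  refine ⟨fun t => max 0 (min 1 (2 * t - 1 / 2)) / max t (3 / 4), ?_, h0 0 (by norm_num), h0,
    fun t ht => ?_⟩
  · refine Continuous.div (by fun_prop) (by fun_prop) fun t => ?_
    have : (3 / 4 : ℝ) ≤ max t (3 / 4) := le_max_right _ _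
    linarith
  · beta_reduce
    rw [min_eq_left (by linarith), max_eq_left ht.le, max_eq_right zero_le_one]

/-- If `g` is close to being a projection, it is close to having an inverse in the corner defined
by the projection it is close to. -/
theorem exists_quasi_inverse {A : Type*} [NonUnitalCStarAlgebra A] [PartialOrder A]
    [StarOrderedRing A] {g : A} (hg : 0 ≤ g) (hg1 : ‖g‖ ≤ 1) {κ : ℝ}
    (hκ : ‖g * g - g * g * g‖ ≤ κ) (hκ' : κ < 1 / 64) :
    ∃ k : A, IsSelfAdjoint k ∧ (∀ b, Commute g b → Commute k b) ∧ k * k * g = k ∧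
      ‖g * g - k‖ ≤ 24 * κ := by
  have hgs : IsSelfAdjoint g := .of_nonneg hg
  obtain ⟨m, hm, m0, hm4, hm34⟩ := exists_continuous_cutoff_inv
  have hgg : g * g = cfcₙ (fun t : ℝ => t * t) g := by
    nth_rw 1 2 [← cfcₙ_id ℝ g]
    exact (cfcₙ_mul id id g).symm
  have hggg : g * g * g = cfcₙ (fun t : ℝ => t * t * t) g := by
    rw [hgg]
    nth_rw 2 [← cfcₙ_id ℝ g]
    exact (cfcₙ_mul (fun t : ℝ => t * t) id g).symm
  rw [hggg, hgg, ← cfcₙ_sub (fun t : ℝ => t * t) (fun t : ℝ => t * t * t) g] at hκ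
  have hspec : ∀ t ∈ quasispectrum ℝ g, 0 ≤ t ∧ t ≤ 1 ∧ t * t - t * t * t ≤ κ := fun t ht => by
    refine ⟨quasispectrum_nonneg_of_nonneg g hg t ht, ?_, ?_⟩
    · have := norm_apply_le_norm_cfcₙ (id : ℝ → ℝ) g ht
      rw [cfcₙ_id ℝ g] at this
      exact (le_abs_self t).trans (this.trans hg1)
    · exact (le_abs_self _).trans
        ((norm_apply_le_norm_cfcₙ (fun t : ℝ => t * t - t * t * t) g ht).trans hκ)
  have hgap : ∀ t ∈ quasispectrum ℝ g, (m t = 0 ∧ t < 1 / 4) ∨ (m t = 1 / t ∧ 3 / 4 < t) := by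
    intro t ht
    obtain ⟨h0, h1, h2⟩ := hspec t ht
    by_cases ht4 : t < 1 / 4
    · left
      exact ⟨hm4 t ht4, ht4⟩
    · right
      -- On `[1/4, 3/4]` one has `t² - t³ ≥ 3/64 > κ`, so the spectrum has a gap there.
      have ht34 : 3 / 4 < t := by
        by_contra hcon
        nlinarith [mul_nonneg (by linarith : 0 ≤ t - 1 / 4) (by linarith : 0 ≤ 3 / 4 - t)]
      exact ⟨hm34 t ht34, ht34⟩
  have hkkg : cfcₙ m g * cfcₙ m g * g = cfcₙ (fun t => m t * m t * t) g := by
    rw [← cfcₙ_mul m m g]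
    nth_rw 2 [← cfcₙ_id ℝ g]
    exact (cfcₙ_mul (fun t => m t * m t) id g).symm
  refine ⟨cfcₙ m g, cfcₙ_predicate m g, fun b hb => hb.cfcₙ_real m, ?_, ?_⟩
  · rw [hkkg]
    refine cfcₙ_congr fun t ht => ?_
    rcases hgap t ht with ⟨h, -⟩ | ⟨h, h'⟩
    · simp [h]
    · have : t ≠ 0 := by linarith
      simp only [h]; field_simp
  -- Below the gap `t² ≤ (4/3) κ`; above it `|t² - 1/t| ≤ (10/3)(1 - t)` and `1 - t ≤ 4 κ`. The
  -- constant `24` leaves room.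
  · rw [hgg, ← cfcₙ_sub (fun t : ℝ => t * t) m g]
    refine norm_cfcₙ_le fun t ht => ?_
    obtain ⟨h0, h1, h2⟩ := hspec t ht
    rw [Real.norm_eq_abs, abs_le]
    rcases hgap t ht with ⟨h, h'⟩ | ⟨h, h'⟩
    · rw [h]
      constructor <;> nlinarith [mul_nonneg h0 h0, mul_nonneg (mul_nonneg h0 h0) (by linarith : 0 ≤ 1 / 4 - t)]
    · have ht0 : 0 < t := by linarith
      have e : 1 / t * t = 1 := by field_simp
      have h5 : 1 / t ≤ 4 / 3 := by rw [div_le_iff₀ ht0]; linarith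
      have h6 : 1 ≤ 1 / t := by rw [le_div_iff₀ ht0]; linarith
      have h7 : 1 - t ≤ 4 * κ := by nlinarith [mul_nonneg (by linarith : 0 ≤ t - 3 / 4) (by linarith : 0 ≤ 1 - t), mul_nonneg (mul_nonneg (by linarith : 0 ≤ t - 3 / 4) (by linarith : 0 ≤ t)) (by linarith : 0 ≤ 1 - t)]
      have h8 : 1 / t - 1 ≤ 4 / 3 * (1 - t) := by nlinarith
      rw [h]
      constructor <;> nlinarith

/-- The image of the corner `q F q` under a map of order zero, corrected by a quasi-inverse `k` of
`φ q`, as a ⋆-subalgebra. -/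
def orderZeroCorner {F A : Type*} [CStarAlgebra F] [PartialOrder F] [StarOrderedRing F]
    [NonUnitalCStarAlgebra A] [PartialOrder A] [StarOrderedRing A] (φ : F →CP A)
    (hφ : ∀ x y, φ x * φ y = φ 1 * φ (x * y)) {q : F} (hq : IsStarProjection q) {k : A}
    (hk : IsSelfAdjoint k) (hkc : ∀ b, Commute (φ q) b → Commute k b)
    (hkk : k * k * φ q = k) : NonUnitalStarSubalgebra ℂ A :=
  have hcomm : ∀ x, q * x = x → x * q = x → Commute k (φ x) := fun x h1 h2 =>
    hkc _ (by rw [Commute, SemiconjBy, hφ q x, hφ x q, h1, h2])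
  { carrier := {a | ∃ x, q * x = x ∧ x * q = x ∧ a = k * φ x}
    add_mem' := by
      rintro _ _ ⟨x, hx, hx', rfl⟩ ⟨y, hy, hy', rfl⟩
      exact ⟨x + y, by rw [mul_add, hx, hy], by rw [add_mul, hx', hy'], by rw [map_add, mul_add]⟩
    zero_mem' := ⟨0, by simp, by simp, by simp⟩
    mul_mem' := by
      rintro _ _ ⟨x, hx, hx', rfl⟩ ⟨y, hy, hy', rfl⟩
      refine ⟨x * y, by rw [← mul_assoc, hx], by rw [mul_assoc, hy'], ?_⟩
      calc k * φ x * (k * φ y) = k * (φ x * k) * φ y := by simp only [mul_assoc]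
        _ = k * k * (φ x * φ y) := by rw [← (hcomm x hx hx').eq]; simp only [mul_assoc]
        -- The multiplier `φ 1` may be replaced by `φ q` because `q` is a unit for `x * y`.
        _ = k * k * (φ q * φ (x * y)) := by rw [hφ x y, hφ q (x * y), ← mul_assoc q, hx]
        _ = k * φ (x * y) := by rw [← mul_assoc, hkk]
    smul_mem' := by
      rintro c _ ⟨x, hx, hx', rfl⟩
      exact ⟨c • x, by rw [mul_smul_comm, hx], by rw [smul_mul_assoc, hx'],
        by rw [map_smul, mul_smul_comm]⟩
    star_mem' := by
      rintro _ ⟨x, hx, hx', rfl⟩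
      have h1 : q * star x = star x := by
        have := congrArg star hx'; rwa [star_mul, hq.isSelfAdjoint.star_eq] at this
      have h2 : star x * q = star x := by
        have := congrArg star hx; rwa [star_mul, hq.isSelfAdjoint.star_eq] at this
      exact ⟨star x, h1, h2, by
        rw [star_mul, ← φ.map_star, hk.star_eq, (hcomm _ h1 h2).eq]⟩ }

/-- Put `x₀ = ψ e₀`, `y = ψ b`, `h = φ 1`, let `q` be the spectral projection of `x₀` above `η`, and
`g = φ q`. Once `g² - g³` is small, `g` has a quasi-inverse `k`, and `z = q x₀ y x₀ q` gives the
approximant `k φ(z)`. The error bound follows the chain `b ≈ e₀ b e₀ ≈ φ(x₀) φ(y) φ(x₀) = h² φ(x₀ y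
x₀) ≈ h² φ(z) = g² φ(z) ≈ k φ(z)`, one summand per approximation. -/
theorem exists_finiteDimensional_of_orderZero_factorization {F A : Type*} [CStarAlgebra F]
    [PartialOrder F] [StarOrderedRing F] [FiniteDimensional ℂ F] [NonUnitalCStarAlgebra A]
    [PartialOrder A] [StarOrderedRing A] (φ : F →CP A) (ψ : A →CP F)
    (hφ : ∀ x y, φ x * φ y = φ 1 * φ (x * y)) (hφ1 : ∀ x, ‖φ x‖ ≤ ‖x‖) (hψ1 : ∀ a, ‖ψ a‖ ≤ ‖a‖)
    {e₀ e₁ : A} (he₀ : 0 ≤ e₀) (he₁ : 0 ≤ e₁) (he₀1 : ‖e₀‖ ≤ 1) (he₁1 : ‖e₁‖ ≤ 1)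
    {δ η : ℝ} (hη : 0 < η) (hδη : 4 * δ / η ^ 2 < 1 / 64)
    (h₀ : ‖φ (ψ e₀) - e₀‖ ≤ δ) (h₁ : ‖φ (ψ e₁) - e₁‖ ≤ δ) (h₁₀ : ‖e₁ * e₀ - e₀‖ ≤ δ) :
    ∃ C : NonUnitalStarSubalgebra ℂ A, FiniteDimensional ℂ C ∧ ∀ (b : A) (M : ℝ), ‖b‖ ≤ M →
      ‖φ (ψ b) - b‖ ≤ δ → ∃ c ∈ C, ‖b - c‖ ≤ ‖b - e₀ * b * e₀‖ + (2 * M + 1) * δ + 2 * η * M +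
        24 * (4 * δ / η ^ 2) * M := by
  have hδ : 0 ≤ δ := (norm_nonneg _).trans h₀
  have φmono : ∀ x, 0 ≤ x → 0 ≤ φ x := fun x hx => map_nonneg φ hx
  set x₀ := ψ e₀ with hx₀
  set x₁ := ψ e₁ with hx₁
  set h := φ 1 with hh
  have hx₀0 : 0 ≤ x₀ := map_nonneg ψ he₀
  have hx₁0 : 0 ≤ x₁ := map_nonneg ψ he₁
  have hx₀s : IsSelfAdjoint x₀ := .of_nonneg hx₀0
  have hx₀1 : ‖x₀‖ ≤ 1 := (hψ1 _).trans he₀1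
  have hx₁1 : ‖x₁‖ ≤ 1 := (hψ1 _).trans he₁1
  have hh0 : 0 ≤ h := φmono 1 zero_le_one
  have hh1 : ‖h‖ ≤ 1 := (hφ1 _).trans (IsStarProjection.one F).norm_le
  have hcomm : ∀ x, h * φ x = φ x * h := fun x => by rw [hφ x 1, mul_one]
  obtain ⟨q, hq, hqc, hqle, hqn⟩ := exists_isStarProjection_cutoff hx₀s hη
  have hq1 : ‖q‖ ≤ 1 := hq.norm_le
  set g := φ q with hg
  have hg0 : 0 ≤ g := φmono q hq.nonneg
  have hg1 : ‖g‖ ≤ 1 := (hφ1 _).trans hq1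
  -- positivity of `φ(v⋆ v) h - φ(v⋆ v) h²`
  have Tpos : ∀ w, 0 ≤ w → 0 ≤ h * φ w - h * (h * φ w) := by
    intro w hw
    obtain ⟨v, rfl⟩ := exists_star_mul_self_of_nonneg hw
    have e1 : h * φ (star v * v) = star (φ v) * φ v := by rw [← φ.map_star, ← hφ]
    have e2 : h * (h * φ (star v * v)) = star (φ v) * h * φ v := by
      rw [e1, ← mul_assoc, ← φ.map_star, hcomm]
    rw [e2, e1, sub_nonneg]
    refine (CStarAlgebra.star_left_conjugate_le_norm_smul (.of_nonneg hh0)).trans ?_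
    calc _ ≤ (1 : ℝ) • (star (φ v) * φ v) :=
          smul_le_smul_of_nonneg_right hh1 (star_mul_self_nonneg _)
      _ = _ := one_smul _ _
  have hhpos : ∀ w, 0 ≤ w → 0 ≤ h * (h * φ w) := by
    intro w hw
    obtain ⟨v, rfl⟩ := exists_star_mul_self_of_nonneg hw
    have e1 : h * (h * φ (star v * v)) = star (φ v) * h * φ v := by
      rw [← hφ, ← mul_assoc, φ.map_star, ← φ.map_star, hcomm]
    rw [e1]
    exact star_left_conjugate_nonneg hh0 _
  have hgg : g * g = h * φ q := by rw [hg, hφ, hq.isIdempotentElem.eq]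
  have hggg : g * g * g = h * (h * φ q) := by rw [hgg, mul_assoc, hg, hφ, hq.isIdempotentElem.eq]
  -- The cutoff gives `η² q ≤ x₀²`, and `x₁ ≤ 1`; so `η² (g² - g³)` is dominated by `h φ(x₀²) - h²
  -- φ(x₀ x₁ x₀) = φ(x₀)(φ(x₀) - φ(x₁) φ(x₀))`. The latter is small because `φ(x₁) φ(x₀) ≈ e₁ e₀ ≈
  -- e₀ ≈ φ(x₀)`.
  have hκ : ‖g * g - g * g * g‖ ≤ 4 * δ / η ^ 2 := by
    have hD : ‖φ x₀ * (φ x₀ - φ x₁ * φ x₀)‖ ≤ 4 * δ := by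
      have e1 : φ x₀ - φ x₁ * φ x₀ = (φ x₀ - e₀) - (φ x₁ - e₁) * φ x₀ - e₁ * (φ x₀ - e₀) -
          (e₁ * e₀ - e₀) := by noncomm_ring
      have n0 : ‖φ x₀‖ ≤ 1 := (hφ1 _).trans hx₀1
      have n1 : ‖(φ x₁ - e₁) * φ x₀‖ ≤ δ * 1 := norm_mul_le_of_le h₁ n0
      have n2 : ‖e₁ * (φ x₀ - e₀)‖ ≤ 1 * δ := norm_mul_le_of_le he₁1 h₀
      have n3 : ‖φ x₀ - φ x₁ * φ x₀‖ ≤ 4 * δ := by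
        rw [e1]
        refine (norm_sub_le_of_le (norm_sub_le_of_le (norm_sub_le_of_le h₀ n1) n2) h₁₀).trans ?_
        linarith
      refine (norm_mul_le_of_le n0 n3).trans (by linarith)
    have eD : φ x₀ * (φ x₀ - φ x₁ * φ x₀) = h * φ (x₀ * x₀) - h * (h * φ (x₀ * x₁ * x₀)) := by
      rw [mul_sub, hφ x₀ x₀, hφ x₁ x₀, ← mul_assoc, ← hcomm, mul_assoc, hφ x₀ (x₁ * x₀),
        mul_assoc x₀]
    have hle1 : 0 ≤ h * (h * φ (x₀ * x₀ - x₀ * x₁ * x₀)) := hhpos _ (by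
      have h2 : x₁ ≤ 1 := (CStarAlgebra.norm_le_one_iff_of_nonneg x₁ hx₁0).mp hx₁1
      have h3 := star_left_conjugate_le_conjugate h2 x₀
      rw [hx₀s.star_eq, mul_one] at h3
      exact sub_nonneg.mpr h3)
    have hle2 := Tpos _ (sub_nonneg.mpr hqle)
    have hle : η ^ 2 • (g * g - g * g * g) ≤ φ x₀ * (φ x₀ - φ x₁ * φ x₀) := by
      have φr : ∀ (c : ℝ) x, φ (c • x) = c • φ x := fun c x =>
        LinearMap.map_smul_of_tower φ.toLinearMap c x
      rw [← sub_nonneg]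
      refine (add_nonneg hle1 hle2).trans_eq ?_
      rw [eD, hggg, hgg]
      simp only [map_sub, φr, mul_sub, smul_sub, mul_smul_comm]
      abel
    have hpos : 0 ≤ η ^ 2 • (g * g - g * g * g) := by
      rw [hggg, hgg]
      exact smul_nonneg (by positivity) (Tpos q hq.nonneg)
    have := (CStarAlgebra.norm_le_norm_of_nonneg_of_le hpos hle).trans hD
    rw [norm_smul, Real.norm_of_nonneg (by positivity)] at this
    rw [le_div_iff₀ (by positivity)]
    linarith
  obtain ⟨k, hk, hkc, hkk, hkn⟩ := exists_quasi_inverse hg0 hg1 hκ hδη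
  refine ⟨orderZeroCorner φ hφ hq hk hkc hkk, ?_, fun b M hbM hb => ?_⟩
  · have hfd : FiniteDimensional ℂ (LinearMap.range (LinearMap.mulLeft ℂ k ∘ₗ φ.toLinearMap)) :=
      inferInstance
    refine Submodule.finiteDimensional_of_le
      (S₁ := (orderZeroCorner φ hφ hq hk hkc hkk).toSubmodule) (S₂ := LinearMap.range
        (LinearMap.mulLeft ℂ k ∘ₗ φ.toLinearMap)) ?_
    rintro _ ⟨x, -, -, rfl⟩
    exact ⟨x, rfl⟩
  · have hM : 0 ≤ M := (norm_nonneg b).trans hbM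
    set y := ψ b with hy
    have hyM : ‖y‖ ≤ M := (hψ1 b).trans hbM
    have hφyM : ‖φ y‖ ≤ M := (hφ1 y).trans hyM
    have hqx1 : ‖q * x₀‖ ≤ 1 := (norm_mul_le_of_le hq1 hx₀1).trans (by norm_num)
    have n0 : ‖φ x₀‖ ≤ 1 := (hφ1 _).trans hx₀1
    let z := (q * x₀) * y * (x₀ * q)
    have hqz : q * z = z := by
      simp only [z, ← mul_assoc, hq.isIdempotentElem.eq]
    have hzq : z * q = z := by
      simp only [z, mul_assoc, hq.isIdempotentElem.eq]
    have hz : ‖z‖ ≤ M := by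
      have h1 : ‖x₀ * q‖ ≤ 1 := by rw [← hqc.eq]; exact hqx1
      refine (norm_mul_le_of_le (norm_mul_le_of_le hqx1 hyM) h1).trans (by linarith)
    refine ⟨k * φ z, ⟨z, hqz, hzq, rfl⟩, ?_⟩
    have s1 : ‖e₀ * b * e₀ - φ x₀ * φ y * φ x₀‖ ≤ (2 * M + 1) * δ := by
      have e1 : e₀ * b * e₀ - φ x₀ * φ y * φ x₀ = -((φ x₀ - e₀) * b * e₀) -
          φ x₀ * (φ y - b) * e₀ - φ x₀ * φ y * (φ x₀ - e₀) := by noncomm_ring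
      have t1 : ‖(φ x₀ - e₀) * b * e₀‖ ≤ δ * M * 1 :=
        norm_mul_le_of_le (norm_mul_le_of_le h₀ hbM) he₀1
      have t2 : ‖φ x₀ * (φ y - b) * e₀‖ ≤ 1 * δ * 1 :=
        norm_mul_le_of_le (norm_mul_le_of_le n0 hb) he₀1
      have t3 : ‖φ x₀ * φ y * (φ x₀ - e₀)‖ ≤ 1 * M * δ :=
        norm_mul_le_of_le (norm_mul_le_of_le n0 hφyM) h₀
      rw [e1]
      rw [← norm_neg] at t1
      refine (norm_sub_le_of_le (norm_sub_le_of_le t1 t2) t3).trans ?_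
      linarith
    have e2 : φ x₀ * φ y * φ x₀ = h * (h * φ (x₀ * y * x₀)) := by
      rw [hφ x₀ y, mul_assoc, hφ (x₀ * y) x₀]
    have e3 : g * g * φ z = h * (h * φ z) := by
      rw [mul_assoc, hg, hφ q z, hqz, ← mul_assoc, ← hcomm, mul_assoc, hφ q z, hqz]
    have s2 : ‖h * (h * φ (x₀ * y * x₀)) - h * (h * φ z)‖ ≤ 2 * η * M := by
      have e4 : h * (h * φ (x₀ * y * x₀)) - h * (h * φ z) =
          h * (h * φ ((x₀ - q * x₀) * y * x₀ + (q * x₀) * y * (x₀ - q * x₀))) := by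
        have : x₀ * y * x₀ = (x₀ - q * x₀) * y * x₀ + (q * x₀) * y * (x₀ - q * x₀) + z := by
          simp only [z, ← hqc.eq]; noncomm_ring
        rw [this, map_add, mul_add, mul_add, add_sub_cancel_right]
      have t1 : ‖(x₀ - q * x₀) * y * x₀‖ ≤ η * M * 1 :=
        norm_mul_le_of_le (norm_mul_le_of_le hqn hyM) hx₀1
      have t2 : ‖(q * x₀) * y * (x₀ - q * x₀)‖ ≤ 1 * M * η :=
        norm_mul_le_of_le (norm_mul_le_of_le hqx1 hyM) hqn
      rw [e4]
      refine (norm_mul_le_of_le hh1 (norm_mul_le_of_le hh1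
        ((hφ1 _).trans (norm_add_le_of_le t1 t2)))).trans ?_
      linarith
    have s3 : ‖g * g * φ z - k * φ z‖ ≤ 24 * (4 * δ / η ^ 2) * M := by
      rw [← sub_mul]
      exact norm_mul_le_of_le hkn ((hφ1 z).trans hz)
    have e5 : b - k * φ z = (b - e₀ * b * e₀) + (e₀ * b * e₀ - φ x₀ * φ y * φ x₀) +
        (h * (h * φ (x₀ * y * x₀)) - h * (h * φ z)) + (g * g * φ z - k * φ z) := by
      rw [e2, e3]; abel
    rw [e5]
    exact norm_add_le_of_le (norm_add_le_of_le (norm_add_le_of_le le_rfl s1) s2) s3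

end LocalApproximation

/-! ### Decomposition rank zero gives local approximation -/

section DecompositionRankZero

theorem iInf_natCast_eq_zero_iff {p : ℕ → Prop} : (⨅ (n : ℕ) (_ : p n), (n : ℕ∞)) = 0 ↔ p 0 := by
  constructor
  · intro h
    by_contra h0
    have : (1 : ℕ∞) ≤ ⨅ (n : ℕ) (_ : p n), (n : ℕ∞) := by
      refine le_iInf₂ fun n hn => ?_
      have : 1 ≤ n := Nat.one_le_iff_ne_zero.mpr fun h1 => h0 (h1 ▸ hn)
      exact_mod_cast this
    rw [h] at this
    simp at this
  · exact fun h => le_antisymm (iInf₂_le_of_le 0 h (by simp)) bot_le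

theorem decompositionRank_eq_zero_iff {A : Type*} [NonUnitalCStarAlgebra A] [PartialOrder A]
    [StarOrderedRing A] : decompositionRank A = 0 ↔ HasDecompositionRankLE A 0 :=
  iInf_natCast_eq_zero_iff

theorem strictOrder_eq_zero_iff {F A : Type*} [NonUnitalCStarAlgebra F] [PartialOrder F]
    [NonUnitalCStarAlgebra A] {φ : F →ₗ[ℂ] A} : strictOrder φ = 0 ↔ HasStrictOrderLE φ 0 :=
  iInf_natCast_eq_zero_iff

/-- There is one colour, so its fibre is the whole index set; the content is the transport of
minimal projections along the identification `ρ` of the two sums. -/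
theorem IsDecomposable.hasStrictOrderLE_zero {A : Type*} [NonUnitalCStarAlgebra A] [PartialOrder A]
    [StarOrderedRing A] {s : ℕ} {r : Fin s → ℕ} {φ : MatrixSum r →CP A}
    (h : IsDecomposable φ 0) : HasStrictOrderLE φ.toLinearMap 0 := by
  obtain ⟨c, hc⟩ := h
  have hc0 : ∀ i, c i = 0 := fun i => Fin.eq_zero (c i)
  have h0 := strictOrder_eq_zero_iff.mp (hc 0)
  intro e he ho
  let ρ : MatrixSum r → MatrixSum (fun i : {i // c i = 0} => r i) := fun x i => x i
  have hincl : ∀ x, MatrixSum.incl r (fun i => c i = 0) (ρ x) = x := fun x => by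
    funext i
    exact dif_pos (hc0 i)
  have hmin : ∀ i, IsMinimalProjection (ρ (e i)) := fun i => by
    obtain ⟨h1, h2, h3⟩ := he i
    refine ⟨⟨congrArg ρ h1.isIdempotentElem, congrArg ρ h1.isSelfAdjoint⟩, fun h => h2 ?_,
      fun q hq hqe => ?_⟩
    · rw [← hincl (e i), h, map_zero]
    · let q' : MatrixSum r := fun i => q ⟨i, hc0 i⟩
      have hq' : ρ q' = q := rfl
      rcases h3 q' ⟨funext fun i => congrFun hq.isIdempotentElem ⟨i, hc0 i⟩,
        funext fun i => congrFun hq.isSelfAdjoint ⟨i, hc0 i⟩⟩ (fun i => hqe ⟨i, hc0 i⟩) with h | h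
      · left; rw [← hq', h]; rfl
      · right; rw [← hq', h]
  have hort : ∀ i j, i ≠ j → CStarOrthogonal (ρ (e i)) (ρ (e j)) := fun i j hij => by
    obtain ⟨h1, h2, h3, h4⟩ := ho i j hij
    exact ⟨congrArg ρ h1, congrArg ρ h2, congrArg ρ h3, congrArg ρ h4⟩
  simpa only [LinearMap.comp_apply, hincl] using h0 (fun i => ρ (e i)) hmin hort

instance MatrixSum.finiteDimensional {s : ℕ} {r : Fin s → ℕ} :
    FiniteDimensional ℂ (MatrixSum r) :=
  have : ∀ i, FiniteDimensional ℂ (CStarMatrix (Fin (r i)) (Fin (r i)) ℂ) := fun i =>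
    inferInstanceAs (FiniteDimensional ℂ (Matrix (Fin (r i)) (Fin (r i)) ℂ))
  inferInstance

/-- Every finite subset of an algebra of decomposition rank zero is approximately contained in a
finite-dimensional ⋆-subalgebra. -/
theorem HasDecompositionRankLE.exists_finiteDimensional_approx {A : Type*} [NonUnitalCStarAlgebra A]
    [PartialOrder A] [StarOrderedRing A] (h : HasDecompositionRankLE A 0) (S : Finset A) {ε : ℝ}
    (hε : 0 < ε) : ∃ C : NonUnitalStarSubalgebra ℂ A, FiniteDimensional ℂ C ∧
      ∀ b ∈ S, ∃ c ∈ C, ‖b - c‖ < ε := by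
  classical
  obtain ⟨M, hM1, hM⟩ : ∃ M : ℝ, 1 ≤ M ∧ ∀ b ∈ S, ‖b‖ ≤ M := by
    obtain ⟨M, hM⟩ := (S.finite_toSet.image norm).bddAbove
    exact ⟨max 1 M, le_max_left _ _, fun b hb => (hM ⟨b, hb, rfl⟩).trans (le_max_right _ _)⟩
  have hM0 : 0 < M := by linarith
  -- Error budget: `ε/4` for the cut-down by `e₀`, at most `ε/8` for the terms linear in `δ`, `2 η M
  -- = ε/4` for the spectral cutoff, and at most `ε/4` for the quasi-inverse.
  let η := ε / (8 * M)
  have hη : 0 < η := by positivity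
  obtain ⟨δ, hδ, hδ1, hδ2, hδ3⟩ : ∃ δ : ℝ, 0 < δ ∧ (2 * M + 1) * δ ≤ ε / 8 ∧
      4 * δ / η ^ 2 < 1 / 64 ∧ 24 * (4 * δ / η ^ 2) * M ≤ ε / 4 := by
    refine ⟨min (ε / (8 * (2 * M + 1))) (min (η ^ 2 / 512) (ε * η ^ 2 / (384 * M))), by positivity,
      ?_, ?_, ?_⟩
    · calc _ ≤ (2 * M + 1) * (ε / (8 * (2 * M + 1))) := by gcongr; exact min_le_left _ _
        _ = ε / 8 := by field_simp
    · calc _ ≤ 4 * (η ^ 2 / 512) / η ^ 2 := by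
            gcongr; exact (min_le_right _ _).trans (min_le_left _ _)
        _ < 1 / 64 := by field_simp; norm_num
    · calc _ ≤ 24 * (4 * (ε * η ^ 2 / (384 * M)) / η ^ 2) * M := by
            gcongr; exact (min_le_right _ _).trans (min_le_right _ _)
        _ = ε / 4 := by field_simp; norm_num
  have hl := CStarAlgebra.increasingApproximateUnit A
  have := hl.neBot
  have ev0 : ∀ᶠ e in CStarAlgebra.approximateUnit A, ∀ b ∈ S, ‖b - e * b * e‖ < ε / 4 := by
    rw [Filter.eventually_all_finset]
    intro b hb
    have t : Filter.Tendsto (fun e => e * b * e) (CStarAlgebra.approximateUnit A) (nhds b) := by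
      have t1 : Filter.Tendsto (fun e => e * b * e - b * e) (CStarAlgebra.approximateUnit A)
          (nhds 0) := by
        have t2 := ((hl.tendsto_mul_right b).sub_const b).norm
        rw [sub_self, norm_zero] at t2
        refine squeeze_zero_norm' ?_ t2
        filter_upwards [hl.eventually_norm] with e he
        rw [← sub_mul]
        exact (norm_mul_le_of_le le_rfl he).trans_eq (mul_one _)
      simpa using t1.add (hl.tendsto_mul_left b)
    have := (tendsto_const_nhds (x := b)).sub t |>.norm
    rw [sub_self, norm_zero] at this
    exact this.eventually_lt_const (by positivity)
  obtain ⟨e₀, ⟨he₀, he₀n⟩, he₀S⟩ := ((hl.eventually_nonneg.and hl.eventually_norm).and ev0).exists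
  -- `e₁` is chosen after `e₀`, to act almost as a unit on it.
  have ev1 : ∀ᶠ e in CStarAlgebra.approximateUnit A, ‖e * e₀ - e₀‖ < δ := by
    have := ((hl.tendsto_mul_right e₀).sub_const e₀).norm
    rw [sub_self, norm_zero] at this
    exact this.eventually_lt_const hδ
  obtain ⟨e₁, ⟨he₁, he₁n⟩, he₁₀⟩ := ((hl.eventually_nonneg.and hl.eventually_norm).and ev1).exists
  obtain ⟨s, r, ψ, φ, -, hψ, hφ, happ, hdec⟩ := h (insert e₀ (insert e₁ S)) δ hδ
  obtain ⟨C, hC, hCb⟩ := exists_finiteDimensional_of_orderZero_factorization φ ψ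
    (MatrixSum.map_mul_map_of_hasStrictOrderLE_zero φ hdec.hasStrictOrderLE_zero) hφ hψ he₀ he₁ he₀n
    he₁n hη hδ2 (happ e₀ (by simp)).le (happ e₁ (by simp)).le he₁₀.le
  refine ⟨C, hC, fun b hb => ?_⟩
  obtain ⟨c, hc, hbc⟩ := hCb b M (hM b hb) (happ b (by simp [hb])).le
  refine ⟨c, hc, hbc.trans_lt ?_⟩
  have h1 := he₀S b hb
  have h2 : 2 * η * M = ε / 4 := by simp only [η]; field_simp; norm_num
  linarith

end DecompositionRankZero

/-! ### Matrix units of finite-dimensional ⋆-subalgebras -/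

section MatrixUnits

variable {A : Type*} [NonUnitalCStarAlgebra A]

/-- The families `v j` of partial isometries in `B` have the common source projection `P j` and
orthogonal ranges, and the matrix units `v j k * star (v j l)` span `B`. -/
structure IsMatrixUnitSystem (B : NonUnitalStarSubalgebra ℂ A) {J : Type} (r : J → ℕ)
    (v : ∀ j, Fin (r j) → A) (P : J → A) : Prop where
  pos : ∀ j, 0 < r j
  isStarProjection : ∀ j, IsStarProjection (P j)
  ne_zero : ∀ j, P j ≠ 0
  mem : ∀ j k, v j k ∈ B
  star_mul_self : ∀ j k, star (v j k) * v j k = P j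
  star_mul_of_ne : ∀ j k l, k ≠ l → star (v j k) * v j l = 0
  star_mul_of_ne_block : ∀ i j, i ≠ j → ∀ k l, star (v i k) * v j l = 0
  mem_span : ∀ x ∈ B, x ∈ Submodule.span ℂ {y | ∃ j k l, y = v j k * star (v j l)}

theorem mul_eq_self_of_star_mul_self_eq {v P : A} (hP : IsStarProjection P)
    (h : star v * v = P) : v * P = v := by
  rw [← sub_eq_zero, ← CStarRing.star_mul_self_eq_zero_iff]
  have hs := hP.isSelfAdjoint.star_eq
  have hi := hP.isIdempotentElem.eq
  calc star (v * P - v) * (v * P - v) = P * (star v * v) * P - P * (star v * v) -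
        (star v * v) * P + star v * v := by
        rw [star_sub, star_mul, hs]; noncomm_ring
    _ = 0 := by rw [h, hi, hi]; abel

instance NonUnitalStarSubalgebra.isClosed_of_finiteDimensional
    (B : NonUnitalStarSubalgebra ℂ A) [h : FiniteDimensional ℂ B] : IsClosed (B : Set A) :=
  have : FiniteDimensional ℂ B.toSubmodule := h
  B.toSubmodule.closed_of_finiteDimensional

/-- `Q` is the indicator of a nonzero point `t` of the spectrum, which is finite; it stays in `B`
because `B` is closed. -/
theorem exists_spectral_projection (B : NonUnitalStarSubalgebra ℂ A) [FiniteDimensional ℂ B] {y : A}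
    (hy : y ∈ B) (hys : IsSelfAdjoint y) (hy0 : y ≠ 0) :
    ∃ (t : ℝ) (Q : A), t ≠ 0 ∧ Q ∈ B ∧ IsStarProjection Q ∧ Q ≠ 0 ∧ y * Q = t • Q := by
  have hfin := quasispectrum_finite_of_mem_of_finiteDimensional B hy
  have cont : ∀ f : ℝ → ℝ, ContinuousOn f (quasispectrum ℝ y) := fun f => hfin.continuousOn f
  obtain ⟨t, ht, ht0⟩ : ∃ t ∈ quasispectrum ℝ y, t ≠ 0 := by
    by_contra! hcon
    apply hy0
    have : ‖cfcₙ (id : ℝ → ℝ) y‖ ≤ 0 := norm_cfcₙ_le fun t ht => by simp [hcon t ht]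
    rw [cfcₙ_id ℝ y] at this
    exact norm_le_zero_iff.mp this
  let f : ℝ → ℝ := fun x => if x = t then 1 else 0
  have f0 : f 0 = 0 := if_neg ht0.symm
  refine ⟨t, cfcₙ f y, ht0, cfcₙ_mem f hy, ⟨?_, cfcₙ_predicate f y⟩, fun h => ?_, ?_⟩
  · rw [IsIdempotentElem, ← cfcₙ_mul f f y (cont _) f0 (cont _) f0]
    congr 1
    funext x
    by_cases hx : x = t <;> simp [f, hx]
  · have := norm_apply_le_norm_cfcₙ f y ht (cont _) f0 hys
    rw [h] at this
    norm_num [f] at this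
  · nth_rw 1 [← cfcₙ_id ℝ y]
    rw [← cfcₙ_mul id f y (cont _) rfl (cont _) f0, ← cfcₙ_smul t f y (cont _) f0]
    congr 1
    funext x
    by_cases hx : x = t <;> simp [f, hx]

/-- A nonzero finite-dimensional ⋆-subalgebra contains a projection with one-dimensional corner. -/
theorem exists_projection_with_scalar_corner (B : NonUnitalStarSubalgebra ℂ A)
    [hB : FiniteDimensional ℂ B] (hne : ∃ x ∈ B, x ≠ 0) :
    ∃ P ∈ B, IsStarProjection P ∧ P ≠ 0 ∧ ∀ x ∈ B, ∃ c : ℂ, P * x * P = c • P := by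
  have hBf : FiniteDimensional ℂ B.toSubmodule := hB
  let cor : A → Submodule ℂ A := fun P =>
    B.toSubmodule.map (LinearMap.mulRight ℂ P ∘ₗ LinearMap.mulLeft ℂ P)
  have hcor : ∀ P y, y ∈ cor P ↔ ∃ x ∈ B, P * x * P = y := fun P y => Iff.rfl
  let S : Set A := {P | P ∈ B ∧ IsStarProjection P ∧ P ≠ 0}
  have hS : S.Nonempty := by
    obtain ⟨x, hx, hx0⟩ := hne
    obtain ⟨-, Q, -, hQ, hQp, hQ0, -⟩ := exists_spectral_projection B
      (mul_mem (star_mem hx) hx) (IsSelfAdjoint.star_mul_self x)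
      ((CStarRing.star_mul_self_ne_zero_iff x).mpr hx0)
    exact ⟨Q, hQ, hQp, hQ0⟩
  -- Take `P` with `P B P` of least dimension. A nonzero selfadjoint `y` in this corner has a
  -- spectral projection `Q ≤ P`; minimality gives `Q B Q = P B P`, hence `Q = P` and `y = t P`.
  obtain ⟨P, ⟨hP, hPp, hP0⟩, hmin⟩ :=
    (measure fun P : A => Module.finrank ℂ (cor P)).wf.has_min S hS
  refine ⟨P, hP, hPp, hP0, ?_⟩
  have hPs := hPp.isSelfAdjoint.star_eq
  have hPi := hPp.isIdempotentElem.eq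
  have key : ∀ x ∈ B, IsSelfAdjoint x → ∃ t : ℝ, P * x * P = t • P := by
    intro x hx hxs
    by_cases hy0 : P * x * P = 0
    · exact ⟨0, by rw [hy0, zero_smul]⟩
    set y := P * x * P with hy
    have hyB : y ∈ B := mul_mem (mul_mem hP hx) hP
    have hys : IsSelfAdjoint y := by
      rw [IsSelfAdjoint, hy, star_mul, star_mul, hPs, hxs.star_eq, mul_assoc]
    obtain ⟨t, Q, ht0, hQ, hQp, hQ0, hyQ⟩ := exists_spectral_projection B hyB hys hy0
    refine ⟨t, ?_⟩
    have hPQ : P * Q = Q := by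
      have h1 : P * (t • Q) = t • Q := by rw [← hyQ, ← mul_assoc, hy, ← mul_assoc, ← mul_assoc, hPi]
      rw [mul_smul_comm] at h1
      exact smul_right_injective A ht0 h1
    have hQP : Q * P = Q := by
      have := congrArg star hPQ
      rwa [star_mul, hPs, hQp.isSelfAdjoint.star_eq] at this
    have hle : cor Q ≤ cor P := by
      intro w hw
      obtain ⟨b, hb, rfl⟩ := (hcor Q w).mp hw
      refine (hcor P _).mpr ⟨Q * b * Q, mul_mem (mul_mem hQ hb) hQ, ?_⟩
      rw [← mul_assoc, ← mul_assoc, hPQ, mul_assoc, hQP]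
    have heq : cor Q = cor P :=
      Submodule.eq_of_le_of_finrank_le hle (not_lt.mp (hmin Q ⟨hQ, hQp, hQ0⟩))
    have hPmem : P ∈ cor Q := by
      rw [heq]
      exact (hcor P P).mpr ⟨P, hP, by rw [hPi, hPi]⟩
    obtain ⟨b, hb, hbP⟩ := (hcor Q P).mp hPmem
    have hQP' : Q * P = P := by rw [← hbP, ← mul_assoc, ← mul_assoc, hQp.isIdempotentElem.eq]
    have hPQeq : Q = P := by rw [← hQP, hQP']
    have hyP : y * P = y := by rw [hy, mul_assoc, hPi]
    rw [← hyP, ← hPQeq, hyQ]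
  intro x hx
  have hsr : ∀ (t : ℝ) (w : A), w ∈ B → t • w ∈ B := fun t w hw =>
    (B.toSubmodule.restrictScalars ℝ).smul_mem t hw
  have hre : ((realPart x : A)) ∈ B := by
    rw [realPart_apply_coe]
    exact hsr _ _ (add_mem hx (star_mem hx))
  have him : ((imaginaryPart x : A)) ∈ B := by
    rw [imaginaryPart_apply_coe]
    exact B.smul_mem _ (hsr _ _ (sub_mem hx (star_mem hx)))
  obtain ⟨s, hs⟩ := key _ hre (realPart x).2
  obtain ⟨t, ht⟩ := key _ him (imaginaryPart x).2
  refine ⟨(s : ℂ) + Complex.I * (t : ℂ), ?_⟩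
  conv_lhs => rw [← realPart_add_I_smul_imaginaryPart x]
  rw [mul_add, add_mul, mul_smul_comm, smul_mul_assoc, hs, ht, add_smul, mul_smul,
    Complex.coe_smul, Complex.coe_smul]

/-- Identifies the scalar in `y⋆ y = c P` as `‖y‖²`, so that `y` can be normalized to a partial
isometry. -/
theorem smul_projection_eq_norm_smul [PartialOrder A] [StarOrderedRing A] {P : A}
    (hP : IsStarProjection P) {c : ℂ} (hc : 0 ≤ c • P) : c • P = ‖c • P‖ • P := by
  by_cases hP0 : P = 0
  · simp [hP0]
  have hPn : ‖P‖ = 1 := by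
    have h1 : ‖P‖ * ‖P‖ = ‖P‖ := by
      rw [← CStarRing.norm_star_mul_self, hP.isSelfAdjoint.star_eq, hP.isIdempotentElem.eq]
    exact (mul_eq_left₀ (norm_ne_zero_iff.mpr hP0)).mp h1
  have hreal : (starRingEnd ℂ) c = c := by
    have h1 := (IsSelfAdjoint.of_nonneg hc).star_eq
    rw [star_smul, hP.isSelfAdjoint.star_eq] at h1
    exact smul_left_injective ℂ hP0 h1
  obtain ⟨t, rfl⟩ := Complex.conj_eq_iff_real.mp hreal
  rw [norm_smul, hPn, mul_one, Complex.norm_real, Complex.coe_smul]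
  rw [Complex.coe_smul] at hc
  rcases le_or_gt 0 t with ht | ht
  · rw [Real.norm_of_nonneg ht]
  · have h2 : t • P ≤ 0 := by
      have : 0 ≤ (-t) • P := smul_nonneg (by linarith) hP.nonneg
      rwa [neg_smul, Left.nonneg_neg_iff] at this
    have h3 := smul_eq_zero.mp (le_antisymm h2 hc)
    exact absurd (h3.resolve_right hP0) ht.ne

/-- An orthonormal basis of the column space `B P`. -/
theorem exists_orthonormal_column [PartialOrder A] [StarOrderedRing A]
    (B : NonUnitalStarSubalgebra ℂ A)
    [hB : FiniteDimensional ℂ B] {P : A} (hP : P ∈ B) (hPp : IsStarProjection P) (hP0 : P ≠ 0)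
    (hPc : ∀ x ∈ B, ∃ c : ℂ, P * x * P = c • P) :
    ∃ (n : ℕ) (v : Fin n → A), (∀ k, v k ∈ B) ∧ (∀ k, star (v k) * v k = P) ∧
      (∀ k l, k ≠ l → star (v k) * v l = 0) ∧
      ∀ x ∈ B, (∑ k, v k * star (v k)) * (x * P) = x * P := by
  have hBf : FiniteDimensional ℂ B.toSubmodule := hB
  have hPs := hPp.isSelfAdjoint.star_eq
  have hPi := hPp.isIdempotentElem.eq
  let p : ℕ → Prop := fun n => ∃ v : Fin n → A, (∀ k, v k ∈ B) ∧
    (∀ k, star (v k) * v k = P) ∧ (∀ k l, k ≠ l → star (v k) * v l = 0)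
  have bound : ∀ n, p n → n ≤ Module.finrank ℂ B.toSubmodule := by
    rintro n ⟨v, hv, h1, h2⟩
    have hli : LinearIndependent ℂ (fun k => (⟨v k, hv k⟩ : B.toSubmodule)) := by
      rw [Fintype.linearIndependent_iff]
      intro c hc l
      have hc' : ∑ k, c k • v k = 0 := by
        simpa using congrArg Subtype.val hc
      have h3 := congrArg (star (v l) * ·) hc'
      simp only [Finset.mul_sum, mul_smul_comm, mul_zero] at h3
      rw [Finset.sum_eq_single l (fun k _ hk => by rw [h2 l k hk.symm, smul_zero]) (by simp),
        h1] at h3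
      exact (smul_eq_zero.mp h3).resolve_right hP0
    simpa using hli.fintype_card_le_finrank
  -- As `P B P` is scalar, `y⋆ x` is an inner product on `B P` with values in `ℂ P`. Orthonormal
  -- families are linearly independent, so a maximal one exists; a nonzero Gram–Schmidt remainder
  -- `y` would extend it.
  obtain ⟨n, hn, hn1⟩ : ∃ n, p n ∧ ¬ p (n + 1) := by
    by_contra! hcon
    have : ∀ n, p n := fun n => by
      induction n with
      | zero => exact ⟨Fin.elim0, fun k => k.elim0, fun k => k.elim0, fun k => k.elim0⟩
      | succ n ih => exact hcon n ih
    have := bound _ (this (Module.finrank ℂ B.toSubmodule + 1))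
    omega
  obtain ⟨v, hv, h1, h2⟩ := hn
  refine ⟨n, v, hv, h1, h2, fun x hx => ?_⟩
  by_contra hne
  apply hn1
  set y := x * P - (∑ k, v k * star (v k)) * (x * P) with hy
  have hy0 : y ≠ 0 := fun h => hne (sub_eq_zero.mp h).symm
  have hyB : y ∈ B := sub_mem (mul_mem hx hP)
    (mul_mem (sum_mem fun k _ => mul_mem (hv k) (star_mem (hv k))) (mul_mem hx hP))
  have hyP : y * P = y := by rw [hy, sub_mul, mul_assoc, mul_assoc, mul_assoc, hPi]
  have hPy : P * star y = star y := by
    have := congrArg star hyP; rwa [star_mul, hPs] at this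
  have hvy : ∀ k, star (v k) * y = 0 := fun k => by
    have hvP := mul_eq_self_of_star_mul_self_eq hPp (h1 k)
    have hPv : P * star (v k) = star (v k) := by
      have := congrArg star hvP; rwa [star_mul, hPs] at this
    rw [hy, mul_sub, ← mul_assoc (star (v k)) (Finset.sum _ _), Finset.mul_sum,
      Finset.sum_eq_single k, ← mul_assoc (star (v k)) (v k), h1, hPv, sub_self]
    · intro l _ hl
      rw [← mul_assoc, h2 k l hl.symm, zero_mul]
    · simp
  obtain ⟨c, hc⟩ := hPc (star y * y) (mul_mem (star_mem hyB) hyB)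
  have hyy : star y * y = c • P := by
    rw [← hc, ← mul_assoc, hPy, mul_assoc, hyP]
  have hpos := star_mul_self_nonneg y
  have hnorm : star y * y = (‖y‖ ^ 2 : ℝ) • P := by
    rw [hyy] at hpos ⊢
    rw [pow_two, ← CStarRing.norm_star_mul_self, hyy]
    exact smul_projection_eq_norm_smul hPp hpos
  have hy0' : 0 < ‖y‖ := norm_pos_iff.mpr hy0
  let u : A := (‖y‖⁻¹ : ℝ) • y
  have huB : u ∈ B := (B.toSubmodule.restrictScalars ℝ).smul_mem _ hyB
  have huu : star u * u = P := by
    simp only [u, star_smul, smul_mul_assoc, mul_smul_comm, hnorm, smul_smul, star_trivial]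
    rw [show ‖y‖⁻¹ * (‖y‖⁻¹ * ‖y‖ ^ 2) = 1 by field_simp, one_smul]
  have hvu : ∀ k, star (v k) * u = 0 := fun k => by
    simp only [u, mul_smul_comm, hvy, smul_zero]
  have huv : ∀ k, star u * v k = 0 := fun k => by
    have := congrArg star (hvu k)
    rwa [star_mul, star_star, star_zero] at this
  refine ⟨Fin.snoc v u, fun k => ?_, fun k => ?_, fun k l hkl => ?_⟩
  · refine Fin.lastCases ?_ (fun k => ?_) k <;> simp [huB, hv]
  · refine Fin.lastCases ?_ (fun k => ?_) k <;> simp [huu, h1]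
  · induction k using Fin.lastCases with
    | last =>
      induction l using Fin.lastCases with
      | last => exact absurd rfl hkl
      | cast l => simp [huv]
    | cast k =>
      induction l using Fin.lastCases with
      | last => simp [hvu]
      | cast l => simpa using h2 k l (fun h => hkl (by rw [h]))

/-- The annihilator in `B` of a central projection. -/
def NonUnitalStarSubalgebra.annihilator (B : NonUnitalStarSubalgebra ℂ A) (z : A)
    (hz : IsSelfAdjoint z) (hzB : ∀ x ∈ B, z * x = x * z) : NonUnitalStarSubalgebra ℂ A where
  carrier := {x | x ∈ B ∧ z * x = 0}
  add_mem' := fun {x y} hx hy => ⟨add_mem hx.1 hy.1, by rw [mul_add, hx.2, hy.2, add_zero]⟩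
  zero_mem' := ⟨zero_mem B, mul_zero z⟩
  mul_mem' := fun {x y} hx hy => ⟨mul_mem hx.1 hy.1, by rw [← mul_assoc, hx.2, zero_mul]⟩
  smul_mem' := fun c x hx => ⟨B.smul_mem c hx.1, by rw [mul_smul_comm, hx.2, smul_zero]⟩
  star_mem' := fun {x} hx => ⟨star_mem hx.1, by
    have := congrArg star hx.2
    rwa [hzB x hx.1, star_mul, hz.star_eq, star_zero] at this⟩

/-- Induction on the dimension: split off one block at a time. For an orthonormal column basis `v`,
the projection `z = ∑ v_k v_k⋆` fixes every `x v_k`, so `z x z = x z` for `x ∈ B`; taking adjoints,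
`z` is central. The `v_k v_l⋆` span `z B`, and the annihilator of `z` in `B` has smaller dimension.
-/
theorem exists_isMatrixUnitSystem [PartialOrder A] [StarOrderedRing A]
    (B : NonUnitalStarSubalgebra ℂ A) [hB : FiniteDimensional ℂ B] :
    ∃ (J : Type) (_ : Fintype J) (r : J → ℕ) (v : ∀ j, Fin (r j) → A) (P : J → A),
      IsMatrixUnitSystem B r v P := by
  induction hd : Module.finrank ℂ B using Nat.strong_induction_on generalizing B with
  | _ d ih =>
  by_cases hne : ∃ x ∈ B, x ≠ 0
  swap
  · push Not at hne
    exact ⟨Empty, inferInstance, Empty.elim, fun j => j.elim, Empty.elim, fun j => j.elim,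
      fun j => j.elim, fun j => j.elim, fun j => j.elim, fun j => j.elim, fun j => j.elim,
      fun j => j.elim, fun x hx => by rw [hne x hx]; exact Submodule.zero_mem _⟩
  obtain ⟨P, hP, hPp, hP0, hPc⟩ := exists_projection_with_scalar_corner B hne
  obtain ⟨n, v, hv, h1, h2, hcol⟩ := exists_orthonormal_column B hP hPp hP0 hPc
  have hPs := hPp.isSelfAdjoint.star_eq
  have hPi := hPp.isIdempotentElem.eq
  have hvP : ∀ k, v k * P = v k := fun k => mul_eq_self_of_star_mul_self_eq hPp (h1 k)
  have hPv : ∀ k, P * star (v k) = star (v k) := fun k => by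
    have := congrArg star (hvP k); rwa [star_mul, hPs] at this
  set z := ∑ k, v k * star (v k) with hz
  have hzB : z ∈ B := sum_mem fun k _ => mul_mem (hv k) (star_mem (hv k))
  have hzs : IsSelfAdjoint z := by
    rw [IsSelfAdjoint, hz, star_sum]
    exact Finset.sum_congr rfl fun k _ => by rw [star_mul, star_star]
  have hzxv : ∀ x ∈ B, ∀ k, z * (x * v k) = x * v k := fun x hx k => by
    have := hcol (x * v k) (mul_mem hx (hv k))
    rwa [mul_assoc x, hvP] at this
  have hzxz : ∀ x ∈ B, z * (x * z) = x * z := fun x hx => by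
    have : x * z = ∑ k, x * v k * star (v k) := by
      rw [hz, Finset.mul_sum]; simp only [mul_assoc]
    rw [this, Finset.mul_sum]
    exact Finset.sum_congr rfl fun k _ => by rw [← mul_assoc, hzxv x hx]
  have hzv : ∀ k, z * v k = v k := fun k => by
    have := hcol (v k) (hv k); rwa [hvP] at this
  have hcen : ∀ x ∈ B, z * x = x * z := fun x hx => by
    have h3 := congrArg star (hzxz (star x) (star_mem hx))
    rw [star_mul, star_mul, star_star, hzs.star_eq, mul_assoc] at h3
    rw [← h3, hzxz x hx]
  let B' := B.annihilator z hzs hcen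
  have hmem' : ∀ x, x ∈ B' ↔ x ∈ B ∧ z * x = 0 := fun x => Iff.rfl
  have hn : 0 < n := by
    by_contra h
    obtain rfl : n = 0 := by omega
    have := hcol P hP
    rw [hz, Finset.univ_eq_empty, Finset.sum_empty, zero_mul, hPi] at this
    exact hP0 this.symm
  have hBf : FiniteDimensional ℂ B.toSubmodule := hB
  have hle : B'.toSubmodule ≤ B.toSubmodule := fun x hx => hx.1
  have hlt : B'.toSubmodule < B.toSubmodule := by
    refine lt_of_le_of_ne hle fun h => ?_
    have h4 : v ⟨0, hn⟩ ∈ B'.toSubmodule := by rw [h]; exact hv _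
    have h5 := ((hmem' _).mp h4).2
    rw [hzv] at h5
    have h6 := h1 ⟨0, hn⟩
    rw [h5, mul_zero] at h6
    exact hP0 h6.symm
  have hB'f : FiniteDimensional ℂ B' := Submodule.finiteDimensional_of_le hle
  have hfr : Module.finrank ℂ B' < d := hd ▸ Submodule.finrank_lt_finrank_of_lt hlt
  obtain ⟨J, _, r, v', P', hS⟩ := ih _ hfr B' rfl
  have hvv' : ∀ k j l, star (v k) * v' j l = 0 := fun k j l => by
    rw [← hzv k, star_mul, hzs.star_eq, mul_assoc, ((hmem' _).mp (hS.mem j l)).2, mul_zero]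
  refine ⟨Option J, inferInstance, fun o => match o with | none => n | some j => r j,
    fun o => match o with | none => v | some j => v' j,
    fun o => match o with | none => P | some j => P' j, ?_, ?_, ?_, ?_, ?_, ?_, ?_, ?_⟩
  · rintro (_ | j); exacts [hn, hS.pos j]
  · rintro (_ | j); exacts [hPp, hS.isStarProjection j]
  · rintro (_ | j); exacts [hP0, hS.ne_zero j]
  · rintro (_ | j) k; exacts [hv k, (hS.mem j k).1]
  · rintro (_ | j) k; exacts [h1 k, hS.star_mul_self j k]
  · rintro (_ | j) k l hkl; exacts [h2 k l hkl, hS.star_mul_of_ne j k l hkl]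
  · rintro (_ | i) (_ | j) hij k l
    · exact absurd rfl hij
    · exact hvv' k j l
    · have := congrArg star (hvv' l i k)
      rwa [star_mul, star_star, star_zero] at this
    · exact hS.star_mul_of_ne_block i j (fun h => hij (by rw [h])) k l
  · intro x hx
    have hdec : x = z * x + (x - z * x) := by abel
    have h7 : x - z * x ∈ B' := (hmem' _).mpr ⟨sub_mem hx (mul_mem hzB hx), by
      rw [mul_sub, hcen x hx, hzxz x hx, sub_self]⟩
    rw [hdec]
    refine Submodule.add_mem _ ?_ (Submodule.span_mono ?_ (hS.mem_span _ h7))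
    -- The middle factors `v_k⋆ x v_l` lie in the corner `P B P`, hence are multiples of `P`.
    · have h8 : z * x = ∑ k, ∑ l, v k * (star (v k) * x * v l) * star (v l) := by
        rw [hcen x hx, ← hzxz x hx, hz, Finset.sum_mul]
        refine Finset.sum_congr rfl fun k _ => ?_
        simp only [Finset.mul_sum, mul_assoc]
      rw [h8]
      refine Submodule.sum_mem _ fun k _ => Submodule.sum_mem _ fun l _ => ?_
      obtain ⟨c, hc⟩ := hPc (star (v k) * x * v l)
        (mul_mem (mul_mem (star_mem (hv k)) hx) (hv l))
      have h9 : star (v k) * x * v l = c • P := by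
        rw [← hc, mul_assoc P, mul_assoc _ (v l), hvP, mul_assoc (star (v k)), ← mul_assoc P, hPv]
      rw [h9, mul_smul_comm, hvP, smul_mul_assoc]
      exact Submodule.smul_mem _ _ (Submodule.subset_span ⟨none, k, l, rfl⟩)
    · rintro _ ⟨j, k, l, rfl⟩
      exact ⟨some j, k, l, rfl⟩

end MatrixUnits

/-! ### Perturbation of matrix units -/

section Perturbation

open Filter Topology

variable {A : Type*} [NonUnitalCStarAlgebra A]

/-- A neighbourhood of the spectrum of a projection. -/
def nearZeroOne : Set ℝ := Set.Icc (-1 / 4) (1 / 4) ∪ Set.Icc (3 / 4) (5 / 4)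

theorem isCompact_nearZeroOne : IsCompact nearZeroOne := isCompact_Icc.union isCompact_Icc

theorem continuousOn_nearZeroOne {g : ℝ → ℝ} (hg : ContinuousOn g (Set.Ici (3 / 4))) :
    ContinuousOn (fun t => if t ≤ 1 / 2 then 0 else g t) nearZeroOne := by
  have h1 : ContinuousOn (fun t => if t ≤ 1 / 2 then 0 else g t) (Set.Icc (-1 / 4) (1 / 4)) :=
    continuousOn_const.congr fun t ht => if_pos (by linarith [ht.2])
  have h2 : ContinuousOn (fun t => if t ≤ 1 / 2 then 0 else g t) (Set.Icc (3 / 4) (5 / 4)) :=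
    (hg.mono Set.Icc_subset_Ici_self).congr fun t ht => if_neg (by linarith [ht.1])
  exact h1.union_of_isClosed h2 isClosed_Icc isClosed_Icc

theorem IsStarProjection.quasispectrum_subset_nearZeroOne {P : A} (hP : IsStarProjection P) :
    nearZeroOne ∈ 𝓝ˢ (quasispectrum ℝ P) := by
  have h := (isStarProjection_iff_quasispectrum_subset_and_isSelfAdjoint.mp hP).1
  refine mem_nhdsSet_iff_forall.mpr fun t ht => ?_
  rcases h ht with rfl | rfl
  · exact Filter.mem_of_superset (Icc_mem_nhds (by norm_num) (by norm_num)) Set.subset_union_left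
  · exact Filter.mem_of_superset (Icc_mem_nhds (by norm_num) (by norm_num)) Set.subset_union_right

/-- This is upper hemicontinuity of the quasispectrum, applied at `P`. -/
theorem eventually_quasispectrum_subset_nearZeroOne {P : A} (hP : IsStarProjection P) :
    ∀ᶠ a in 𝓝 P, quasispectrum ℝ a ⊆ nearZeroOne := by
  have h := (upperHemicontinuous_quasispectrum ℝ A).isOpen nearZeroOne
  filter_upwards [h.mem_nhds hP.quasispectrum_subset_nearZeroOne] with a ha
  exact subset_of_mem_nhdsSet ha

/-- Continuity of the functional calculus over a fixed compact set, together with `f(P) = P`, which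
only sees the values of `f` at `0` and `1`. -/
theorem tendsto_cfcₙ_of_isStarProjection {ι : Type*} {l : Filter ι} {a : ι → A} {P : A}
    (hP : IsStarProjection P) (ha : Tendsto a l (𝓝 P)) (hs : ∀ i, IsSelfAdjoint (a i)) {f : ℝ → ℝ}
    (hf : ContinuousOn f nearZeroOne) (hf0 : f 0 = 0) (hf1 : f 1 = 1) :
    Tendsto (fun i => cfcₙ f (a i)) l (𝓝 P) := by
  have h := (isStarProjection_iff_quasispectrum_subset_and_isSelfAdjoint.mp hP).1
  have hfP : cfcₙ f P = P := by
    conv_rhs => rw [← cfcₙ_id ℝ P hP.isSelfAdjoint]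
    refine cfcₙ_congr fun t ht => ?_
    rcases h ht with rfl | rfl
    exacts [hf0, hf1]
  have := Filter.Tendsto.cfcₙ isCompact_nearZeroOne f ha
    (ha.eventually (eventually_quasispectrum_subset_nearZeroOne hP)) (.of_forall hs)
    (subset_of_mem_nhdsSet hP.quasispectrum_subset_nearZeroOne) hP.isSelfAdjoint hf hf0
  rwa [hfP] at this

/-- The spectral projection of an almost idempotent element for the part of the spectrum
near `1`. -/
theorem isStarProjection_cfcₙ_of_subset_nearZeroOne {a : A}
    (h : quasispectrum ℝ a ⊆ nearZeroOne) :
    IsStarProjection (cfcₙ (fun t : ℝ => if t ≤ 1 / 2 then 0 else 1) a) := by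
  have hc : ContinuousOn (fun t : ℝ => if t ≤ 1 / 2 then (0 : ℝ) else 1) (quasispectrum ℝ a) :=
    (continuousOn_nearZeroOne continuousOn_const).mono h
  have h0 : (fun t : ℝ => if t ≤ 1 / 2 then (0 : ℝ) else 1) 0 = 0 := by norm_num
  refine ⟨?_, cfcₙ_predicate _ a⟩
  rw [IsIdempotentElem, ← cfcₙ_mul _ _ a hc h0 hc h0]
  congr 1
  funext t
  split_ifs <;> simp

/-- Here `q - e` is a projection, and a projection has norm `0` or `1`. This turns approximate
equality of source projections into exact equality. -/
theorem eq_of_isStarProjection_of_mul_eq {e q : A} (he : IsStarProjection e)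
    (hq : IsStarProjection q) (heq : e * q = e) (hn : ‖q - e‖ < 1) : e = q := by
  have hp : IsStarProjection (q - e) := he.sub_of_mul_eq_left hq heq
  have h1 : ‖q - e‖ * ‖q - e‖ = ‖q - e‖ := by
    rw [← CStarRing.norm_star_mul_self, hp.isSelfAdjoint.star_eq, hp.isIdempotentElem.eq]
  have h2 : ‖q - e‖ = 0 := by
    by_contra h
    exact hn.ne ((mul_eq_left₀ h).mp h1)
  exact (sub_eq_zero.mp (norm_eq_zero.mp h2)).symm

/-- The function `t ↦ t ^ (-1/2)`, cut off near zero. -/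
noncomputable def invSqrtCutoff (t : ℝ) : ℝ := if t ≤ 1 / 2 then 0 else (√t)⁻¹

theorem continuousOn_invSqrtCutoff : ContinuousOn invSqrtCutoff nearZeroOne := by
  refine continuousOn_nearZeroOne (Real.continuous_sqrt.continuousOn.inv₀ fun t ht => ?_)
  have : (0 : ℝ) < t := lt_of_lt_of_le (by norm_num) ht
  exact (Real.sqrt_pos.mpr this).ne'

theorem invSqrtCutoff_zero : invSqrtCutoff 0 = 0 := if_pos (by norm_num)

theorem invSqrtCutoff_one : invSqrtCutoff 1 = 1 := by
  rw [invSqrtCutoff, if_neg (by norm_num), Real.sqrt_one, inv_one]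

theorem invSqrtCutoff_mul_mul (t : ℝ) :
    invSqrtCutoff t * invSqrtCutoff t * t = if t ≤ 1 / 2 then 0 else 1 := by
  by_cases ht : t ≤ 1 / 2
  · rw [invSqrtCutoff, if_pos ht, if_pos ht, mul_zero, zero_mul]
  · have h0 : 0 < t := by linarith [not_le.mp ht]
    rw [invSqrtCutoff, if_neg ht, if_neg ht, ← mul_inv, Real.mul_self_sqrt h0.le,
      inv_mul_cancel₀ h0.ne']

/-- Elements near a partial isometry can be corrected to partial isometries with prescribed source
projection. -/
theorem eventually_star_mul_self_eq {ι : Type*} {l : Filter ι} {x Q : ι → A} {v P : A}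
    (hP : IsStarProjection P) (hv : star v * v = P) (hx : Tendsto x l (𝓝 v))
    (hQ : Tendsto Q l (𝓝 P)) (hQp : ∀ᶠ i in l, IsStarProjection (Q i))
    (hxQ : ∀ᶠ i in l, x i * Q i = x i) :
    Tendsto (fun i => x i * cfcₙ invSqrtCutoff (star (x i) * x i)) l (𝓝 v) ∧
    ∀ᶠ i in l, star (x i * cfcₙ invSqrtCutoff (star (x i) * x i)) *
      (x i * cfcₙ invSqrtCutoff (star (x i) * x i)) = Q i := by
  have hs : ∀ i, IsSelfAdjoint (star (x i) * x i) := fun i => .star_mul_self _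
  have hy : Tendsto (fun i => star (x i) * x i) l (𝓝 P) := hv ▸ hx.star.mul hx
  have hg := tendsto_cfcₙ_of_isStarProjection hP hy hs continuousOn_invSqrtCutoff
    invSqrtCutoff_zero invSqrtCutoff_one
  constructor
  · have := hx.mul hg
    rwa [mul_eq_self_of_star_mul_self_eq hP hv] at this
  have hχ := tendsto_cfcₙ_of_isStarProjection hP hy hs
    (continuousOn_nearZeroOne (g := fun _ => 1) continuousOn_const) (by norm_num) (by norm_num)
  have hn : ∀ᶠ i in l, ‖Q i - cfcₙ (fun t : ℝ => if t ≤ 1 / 2 then 0 else 1)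
      (star (x i) * x i)‖ < 1 := by
    have := (hQ.sub hχ).norm
    rw [sub_self, norm_zero] at this
    exact this.eventually_lt_const one_pos
  filter_upwards [hn, hQp, hxQ, hy.eventually (eventually_quasispectrum_subset_nearZeroOne hP)]
    with i hn hQp hxQ hsp
  set y := star (x i) * x i with hydef
  set G := cfcₙ invSqrtCutoff y with hG
  have hGs : IsSelfAdjoint G := cfcₙ_predicate _ y
  have hGy : Commute G y := (Commute.refl y).cfcₙ_real _
  have hGc : ContinuousOn invSqrtCutoff (quasispectrum ℝ y) := continuousOn_invSqrtCutoff.mono hsp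
  have hGGy : G * G * y = cfcₙ (fun t : ℝ => if t ≤ 1 / 2 then 0 else 1) y := by
    rw [hG, ← cfcₙ_mul _ _ y hGc invSqrtCutoff_zero hGc invSqrtCutoff_zero]
    nth_rw 2 [← cfcₙ_id ℝ y (hs i)]
    rw [← cfcₙ_mul (fun t => invSqrtCutoff t * invSqrtCutoff t) id y (hGc.mul hGc)
      (by simp [invSqrtCutoff_zero]) continuousOn_id rfl]
    congr 1
    funext t
    exact invSqrtCutoff_mul_mul t
  have e1 : star (x i * G) * (x i * G) = G * G * y := by
    rw [star_mul, hGs.star_eq, mul_assoc G G, hGy.eq, hydef]; simp only [mul_assoc]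
  rw [e1]
  -- The source projection is the spectral projection of `x⋆ x` near `1`. It lies below `Q` since `x
  -- Q = x`, and both tend to `P`, so eventually they coincide.
  refine eq_of_isStarProjection_of_mul_eq ?_ hQp ?_ (hGGy ▸ hn)
  · rw [hGGy]; exact isStarProjection_cfcₙ_of_subset_nearZeroOne hsp
  · rw [mul_assoc, hydef, mul_assoc (star (x i)), hxQ]

/-- Partial isometries with orthogonal ranges, whose source projections depend only on the
class of the index. -/
structure IsColumnSystem {R K J : Type*} [NonUnitalRing R] [StarRing R] (c : K → J) (v : K → R) :
    Prop where
  star_mul_self : ∀ k l, c k = c l → star (v k) * v k = star (v l) * v l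
  star_mul_of_ne : ∀ k l, k ≠ l → star (v k) * v l = 0
  mul_star_mul : ∀ k, v k * (star (v k) * v k) = v k

/-- Column systems lift along approximating families of subalgebras. -/
theorem exists_isColumnSystem_lift {ι : Type*} {l : Filter ι}
    {C : ι → NonUnitalStarSubalgebra ℂ A} [∀ i, IsClosed (C i : Set A)]
    (hC : ∀ a, ∃ c : ι → A, (∀ i, c i ∈ C i) ∧ Tendsto c l (𝓝 a)) {K J : Type*} [Finite K]
    [Finite J] {c : K → J} {v : K → A} {P : J → A} (hP : ∀ j, IsStarProjection (P j))
    (h1 : ∀ k, star (v k) * v k = P (c k)) (h2 : ∀ k m, k ≠ m → star (v k) * v m = 0) :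
    ∃ w : K → ι → A, (∀ k i, w k i ∈ C i) ∧ (∀ k, Tendsto (w k) l (𝓝 (v k))) ∧
      ∀ᶠ i in l, IsColumnSystem c (fun k => w k i) := by
  classical
  -- The source projections are lifted first, one per class, so that all columns of a class share
  -- exactly the same one.
  have hQ : ∀ j, ∃ Q : ι → A, (∀ i, Q i ∈ C i) ∧ Tendsto Q l (𝓝 (P j)) ∧
      ∀ᶠ i in l, IsStarProjection (Q i) := fun j => by
    obtain ⟨d, hdC, hd⟩ := hC (P j)
    have hdd : Tendsto (fun i => star (d i) * d i) l (𝓝 (P j)) := by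
      have := hd.star.mul hd
      rwa [(hP j).isSelfAdjoint.star_eq, (hP j).isIdempotentElem.eq] at this
    exact ⟨fun i => cfcₙ (fun t : ℝ => if t ≤ 1 / 2 then 0 else 1) (star (d i) * d i),
      fun i => cfcₙ_mem _ (mul_mem (star_mem (hdC i)) (hdC i)),
      tendsto_cfcₙ_of_isStarProjection (hP j) hdd (fun i => .star_mul_self _)
        (continuousOn_nearZeroOne (g := fun _ => 1) continuousOn_const) (by norm_num) (by norm_num),
      (hdd.eventually (eventually_quasispectrum_subset_nearZeroOne (hP j))).mono fun i hi =>
        isStarProjection_cfcₙ_of_subset_nearZeroOne hi⟩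
  choose Q hQC hQt hQp using hQ
  have key : ∀ T : Finset K, ∃ w : K → ι → A, (∀ k ∈ T, (∀ i, w k i ∈ C i) ∧
      Tendsto (w k) l (𝓝 (v k)) ∧ (∀ᶠ i in l, star (w k i) * w k i = Q (c k) i) ∧
      ∀ m ∈ T, k ≠ m → ∀ᶠ i in l, star (w k i) * w m i = 0) := by
    intro T
    induction T using Finset.induction_on with
    | empty => exact ⟨fun _ _ => 0, by simp⟩
    | insert a T ha ih =>
      obtain ⟨w, hw⟩ := ih
      obtain ⟨d, hdC, hd⟩ := hC (v a)
      have hva := mul_eq_self_of_star_mul_self_eq (hP (c a)) (h1 a)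
      -- Gram–Schmidt: the right factor `Q` prescribes the source, and subtracting the part in the
      -- ranges already built makes the new range exactly orthogonal to them.
      let x : ι → A := fun i => d i * Q (c a) i -
        (∑ k ∈ T, w k i * star (w k i)) * (d i * Q (c a) i)
      have hxC : ∀ i, x i ∈ C i := fun i => by
        have hy : d i * Q (c a) i ∈ C i := mul_mem (hdC i) (hQC _ i)
        exact sub_mem hy (mul_mem (sum_mem fun k hk =>
          mul_mem ((hw k hk).1 i) (star_mem ((hw k hk).1 i))) hy)
      have hxt : Tendsto x l (𝓝 (v a)) := by
        have t1 : Tendsto (fun i => d i * Q (c a) i) l (𝓝 (v a)) := by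
          have := hd.mul (hQt (c a)); rwa [hva] at this
        have t2 : Tendsto (fun i => ∑ k ∈ T, w k i * star (w k i)) l
            (𝓝 (∑ k ∈ T, v k * star (v k))) :=
          tendsto_finsetSum _ fun k hk => (hw k hk).2.1.mul (hw k hk).2.1.star
        have t3 := t1.sub (t2.mul t1)
        have e : (∑ k ∈ T, v k * star (v k)) * v a = 0 := by
          rw [Finset.sum_mul]
          refine Finset.sum_eq_zero fun k hk => ?_
          rw [mul_assoc, h2 k a (fun h => ha (h ▸ hk)), mul_zero]
        rwa [e, sub_zero] at t3
      have hxQ : ∀ᶠ i in l, x i * Q (c a) i = x i := by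
        filter_upwards [hQp (c a)] with i hi
        simp only [x, sub_mul, mul_assoc, hi.isIdempotentElem.eq]
      obtain ⟨ht, hst⟩ := eventually_star_mul_self_eq (hP (c a)) (h1 a) hxt (hQt (c a))
        (hQp (c a)) hxQ
      set wa : ι → A := fun i => x i * cfcₙ invSqrtCutoff (star (x i) * x i) with hwa
      have hwaC : ∀ i, wa i ∈ C i := fun i =>
        mul_mem (hxC i) (cfcₙ_mem _ (mul_mem (star_mem (hxC i)) (hxC i)))
      have horth : ∀ m ∈ T, ∀ᶠ i in l, star (w m i) * wa i = 0 := fun m hm => by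
        have hev : ∀ᶠ i in l, ∀ k ∈ T, m ≠ k → star (w m i) * w k i = 0 := by
          rw [Filter.eventually_all_finset]
          intro k hk
          by_cases hmk : m = k
          · exact .of_forall fun i h => absurd hmk h
          · exact ((hw m hm).2.2.2 k hk hmk).mono fun i hi _ => hi
        filter_upwards [hev, (hw m hm).2.2.1, hQp (c m)] with i h3 h4 h5
        have h6 : star (w m i) * w m i * star (w m i) = star (w m i) := by
          have h7 := mul_eq_self_of_star_mul_self_eq h5 h4
          have := congrArg star h7
          rwa [star_mul, h5.isSelfAdjoint.star_eq, ← h4] at this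
        have h8 : star (w m i) * (∑ k ∈ T, w k i * star (w k i)) = star (w m i) := by
          rw [Finset.mul_sum, Finset.sum_eq_single m, ← mul_assoc, h6]
          · intro k hk hkm
            rw [← mul_assoc, h3 k hk hkm.symm, zero_mul]
          · exact fun h => absurd hm h
        simp only [wa, x]
        rw [← mul_assoc, mul_sub, ← mul_assoc (star (w m i)) (Finset.sum _ _), h8, sub_self,
          zero_mul]
      refine ⟨Function.update w a wa, fun k hk => ?_⟩
      by_cases hka : k = a
      · subst hka
        simp only [Function.update_self]
        refine ⟨hwaC, ht, hst, fun m hm hkm => ?_⟩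
        have hmT := Finset.mem_of_mem_insert_of_ne hm hkm.symm
        rw [Function.update_of_ne hkm.symm]
        filter_upwards [horth m hmT] with i hi
        have := congrArg star hi
        rwa [star_mul, star_star, star_zero] at this
      · have hkT := Finset.mem_of_mem_insert_of_ne hk hka
        rw [Function.update_of_ne hka]
        refine ⟨(hw k hkT).1, (hw k hkT).2.1, (hw k hkT).2.2.1, fun m hm hkm => ?_⟩
        by_cases hma : m = a
        · subst hma
          rw [Function.update_self]
          exact horth k hkT
        · rw [Function.update_of_ne hma]
          exact (hw k hkT).2.2.2 m (Finset.mem_of_mem_insert_of_ne hm hma) hkm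
  have := Fintype.ofFinite K
  obtain ⟨w, hw⟩ := key Finset.univ
  refine ⟨w, fun k => (hw k (Finset.mem_univ k)).1, fun k => (hw k (Finset.mem_univ k)).2.1, ?_⟩
  have e1 : ∀ᶠ i in l, ∀ k, star (w k i) * w k i = Q (c k) i :=
    eventually_all.mpr fun k => (hw k (Finset.mem_univ k)).2.2.1
  have e2 : ∀ᶠ i in l, ∀ k m, k ≠ m → star (w k i) * w m i = 0 := by
    refine eventually_all.mpr fun k => eventually_all.mpr fun m => ?_
    by_cases hkm : k = m
    · exact .of_forall fun i h => absurd hkm h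
    · exact ((hw k (Finset.mem_univ k)).2.2.2 m (Finset.mem_univ m) hkm).mono fun i hi _ => hi
  filter_upwards [e1, e2, eventually_all.mpr hQp] with i h3 h4 h5
  refine ⟨fun k m hkm => by rw [h3, h3, hkm], h4, fun k => ?_⟩
  rw [h3]
  exact mul_eq_self_of_star_mul_self_eq (h5 (c k)) (h3 k)

/-- A natural choice of the unitary in the polar decomposition near `1`. -/
theorem exists_polar_unitary (U : Type*) [CStarAlgebra U] : ∃ Φ : U → U,
    Tendsto Φ (𝓝 1) (𝓝 1) ∧ ∀ᶠ W in 𝓝 (1 : U), Φ W ∈ unitary U ∧ ∀ e f : U,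
      W * e = f * W → W * star e = star f * W → Φ W * e = f * Φ W := by
  let G : U → U := fun W => cfc (fun t : ℝ => (√t)⁻¹) (star W * W)
  have hs : ∀ W : U, IsSelfAdjoint (star W * W) := fun W => .star_mul_self W
  have ht : Tendsto (fun W : U => star W * W) (𝓝 1) (𝓝 1) := by
    have : Continuous fun W : U => star W * W := by fun_prop
    simpa using this.tendsto 1
  have hspec1 : Set.Icc (1 / 2 : ℝ) (3 / 2) ∈ 𝓝ˢ (spectrum ℝ (1 : U)) := by
    refine mem_nhdsSet_iff_forall.mpr fun t ht => ?_
    have h1 : t = 1 := by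
      by_contra hne
      apply ht
      rw [spectrum.mem_resolventSet_iff, ← map_one (algebraMap ℝ U), ← map_sub]
      exact (IsUnit.mk0 _ (sub_ne_zero.mpr hne)).map _
    rw [h1]
    exact Icc_mem_nhds (by norm_num) (by norm_num)
  have hspec : ∀ᶠ W in 𝓝 (1 : U), spectrum ℝ (star W * W) ⊆ Set.Icc (1 / 2 : ℝ) (3 / 2) := by
    have h := (upperHemicontinuous_spectrum ℝ U).isOpen (Set.Icc (1 / 2 : ℝ) (3 / 2))
    exact ht.eventually ((h.mem_nhds hspec1 |> Filter.Eventually.mono) fun a ha =>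
      subset_of_mem_nhdsSet ha)
  have hcont : ContinuousOn (fun t : ℝ => (√t)⁻¹) (Set.Icc (1 / 2 : ℝ) (3 / 2)) := by
    refine Real.continuous_sqrt.continuousOn.inv₀ fun t ht => ?_
    have : (0 : ℝ) < t := lt_of_lt_of_le (by norm_num) ht.1
    exact (Real.sqrt_pos.mpr this).ne'
  have hG : Tendsto G (𝓝 1) (𝓝 1) := by
    have := Filter.Tendsto.cfc isCompact_Icc (fun t : ℝ => (√t)⁻¹) ht hspec (.of_forall hs)
      (subset_of_mem_nhdsSet hspec1) (.one U) hcont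
    simpa [cfc_apply_one] using this
  have hΦ : Tendsto (fun W => W * G W) (𝓝 1) (𝓝 1) := by
    simpa using (tendsto_id (x := 𝓝 (1 : U))).mul hG
  -- `W (W⋆W)^(-1/2)` is an isometry, and near `1` it is invertible, hence unitary. The two
  -- intertwining relations make `W⋆ W` commute with `e`, so the correcting factor does too.
  refine ⟨fun W => W * G W, hΦ, ?_⟩
  have hunit : ∀ᶠ W in 𝓝 (1 : U), IsUnit (W * G W) :=
    hΦ.eventually (Units.isOpen.mem_nhds isUnit_one)
  filter_upwards [hunit, hspec] with W hu hsp
  have hGs : IsSelfAdjoint (G W) := cfc_predicate _ _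
  have hGc := hcont.mono hsp
  have hGy : Commute (G W) (star W * W) := (Commute.refl _).cfc_real _
  refine ⟨?_, fun e f h1 h2 => ?_⟩
  · have e1 : star (W * G W) * (W * G W) = 1 := by
      calc _ = G W * (star W * W) * G W := by
            rw [star_mul, hGs.star_eq]; simp only [mul_assoc]
        _ = G W * G W * (star W * W) := by rw [mul_assoc, ← hGy.eq, mul_assoc]
        _ = cfc (fun t : ℝ => (√t)⁻¹ * (√t)⁻¹ * t) (star W * W) := by
            rw [cfc_mul (fun t : ℝ => (√t)⁻¹ * (√t)⁻¹) (fun t => t) _ (hGc.mul hGc)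
              continuousOn_id, cfc_mul _ _ _ hGc hGc, cfc_id' ℝ _ (hs W)]
        _ = cfc (fun _ : ℝ => (1 : ℝ)) (star W * W) := by
            refine cfc_congr fun t ht => ?_
            have h0 : (0 : ℝ) < t := lt_of_lt_of_le (by norm_num) (hsp ht).1
            simp only [← mul_inv, Real.mul_self_sqrt h0.le, inv_mul_cancel₀ h0.ne']
        _ = 1 := cfc_const_one ℝ _ (hs W)
    refine Unitary.mem_iff.mpr ⟨e1, ?_⟩
    obtain ⟨u, hu⟩ := hu
    rw [← hu] at e1 ⊢
    have h5 : star (u : U) = ↑u⁻¹ := Units.eq_inv_of_mul_eq_one_right e1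
    rw [h5, Units.mul_inv]
  · have h3 : Commute (star W * W) e := by
      have := congrArg star h2
      rw [star_mul, star_mul, star_star, star_star] at this
      rw [Commute, SemiconjBy, mul_assoc, h1, ← mul_assoc, ← mul_assoc, this]
    have h4 : Commute (G W) e := h3.cfc_real _
    rw [mul_assoc, h4.eq, ← mul_assoc, h1, mul_assoc]

/-- The canonical element intertwining two column systems. -/
theorem IsColumnSystem.intertwine {U K J : Type*} [Ring U] [StarRing U] [Fintype K] {c : K → J}
    {v w : K → U} (hv : IsColumnSystem c v) (hw : IsColumnSystem c w) {k m : K} (h : c k = c m) :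
    (∑ k, w k * star (v k) + (1 - ∑ k, w k * star (w k)) * (1 - ∑ k, v k * star (v k))) *
      (v k * star (v m)) = (w k * star (w m)) *
    (∑ k, w k * star (v k) + (1 - ∑ k, w k * star (w k)) * (1 - ∑ k, v k * star (v k))) := by
  classical
  have r1 : ∀ {a b : K → U}, IsColumnSystem c a →
      (∑ k, b k * star (a k)) * a k = b k * (star (a k) * a k) := fun {a b} ha => by
    rw [Finset.sum_mul, Finset.sum_eq_single k, mul_assoc]
    · intro m _ hm
      rw [mul_assoc, ha.star_mul_of_ne m k hm, mul_zero]
    · simp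
  have r2 : ∀ {b : K → U}, star (w m) * (∑ k, w k * star (b k)) =
      star (w m) * w m * star (b m) := fun {b} => by
    rw [Finset.mul_sum, Finset.sum_eq_single m, mul_assoc]
    · intro k _ hk
      rw [← mul_assoc, hw.star_mul_of_ne m k hk.symm, zero_mul]
    · simp
  have r3 : ∀ {a : K → U}, IsColumnSystem c a → star (a m) * a m * star (a m) = star (a m) :=
    fun {a} ha => by
      have := congrArg star (ha.mul_star_mul m)
      rwa [star_mul, star_mul, star_star] at this
  -- Both sides equal `w k * star (v m)`; the complementary summand is killed by `v k` on the right
  -- and by `star (w m)` on the left.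
  have lhs : (∑ k, w k * star (v k) + (1 - ∑ k, w k * star (w k)) *
      (1 - ∑ k, v k * star (v k))) * (v k * star (v m)) = w k * star (v m) := by
    rw [← mul_assoc, add_mul, mul_assoc (1 - _), sub_mul 1 _ (v k), r1 hv, r1 hv,
      hv.mul_star_mul, one_mul, sub_self, mul_zero, add_zero, hv.star_mul_self k m h, mul_assoc,
      r3 hv]
  rw [lhs, mul_assoc, mul_add, ← mul_assoc (star (w m)) (1 - _), mul_sub (star (w m)), r2, r2,
    r3 hw, mul_one, sub_self, zero_mul, add_zero, ← hw.star_mul_self k m h, ← mul_assoc,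
    hw.mul_star_mul]

/-- Conjugation by a unitary of the unitization. -/
noncomputable def conjUnitization (u : Unitization ℂ A) (hu : u ∈ unitary (Unitization ℂ A)) :
    A →⋆ₙₐ[ℂ] Unitization ℂ A where
  toFun a := u * (a : Unitization ℂ A) * star u
  map_smul' c a := by simp
  map_zero' := by simp
  map_add' a b := by simp [mul_add, add_mul]
  map_mul' a b := by
    rw [Unitization.inr_mul]
    calc u * ((a : Unitization ℂ A) * b) * star u = u * a * 1 * b * star u := by
          rw [mul_one]; simp only [mul_assoc]
      _ = u * a * (star u * u) * b * star u := by rw [Unitary.star_mul_self_of_mem hu]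
      _ = _ := by simp only [mul_assoc]
  map_star' a := by simp [mul_assoc]

theorem conjUnitization_apply (u : Unitization ℂ A) (hu : u ∈ unitary (Unitization ℂ A)) (a : A) :
    conjUnitization u hu a = u * (a : Unitization ℂ A) * star u := rfl

theorem conjUnitization_injective (u : Unitization ℂ A) (hu : u ∈ unitary (Unitization ℂ A)) :
    Function.Injective (conjUnitization u hu) := fun a b h => by
  have h1 := congrArg (fun x => star u * x * u) h
  simp only [conjUnitization_apply] at h1
  have e : ∀ x : Unitization ℂ A, star u * (u * x * star u) * u = x := fun x => by
    calc _ = (star u * u) * x * (star u * u) := by simp only [mul_assoc]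
      _ = x := by rw [Unitary.star_mul_self_of_mem hu, one_mul, mul_one]
  rw [e, e] at h1
  exact Unitization.inr_injective h1

/-- A finite-dimensional ⋆-subalgebra can be enlarged so as to approximately contain finitely many
given elements. -/
theorem exists_finiteDimensional_ge_approx [PartialOrder A] [StarOrderedRing A]
    {ι : Type*} {l : Filter ι} [l.NeBot] {C : ι → NonUnitalStarSubalgebra ℂ A}
    [hCf : ∀ i, FiniteDimensional ℂ (C i)]
    (hC : ∀ a, ∃ c : ι → A, (∀ i, c i ∈ C i) ∧ Tendsto c l (𝓝 a))
    (B : NonUnitalStarSubalgebra ℂ A) [FiniteDimensional ℂ B] (S : Finset A) {ε : ℝ} (hε : 0 < ε) :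
    ∃ B' : NonUnitalStarSubalgebra ℂ A, B ≤ B' ∧ FiniteDimensional ℂ B' ∧
      ∀ b ∈ S, ∃ c ∈ B', ‖b - c‖ < ε := by
  obtain ⟨J, _, r, v, P, hS⟩ := exists_isMatrixUnitSystem B
  let K := Σ j, Fin (r j)
  let vK : K → A := fun k => v k.1 k.2
  have h1 : ∀ k : K, star (vK k) * vK k = P k.1 := fun k => hS.star_mul_self _ _
  have h2 : ∀ k m : K, k ≠ m → star (vK k) * vK m = 0 := by
    rintro ⟨i, k⟩ ⟨j, m⟩ hkm
    by_cases hij : i = j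
    · subst hij
      exact hS.star_mul_of_ne i k m fun h => hkm (by rw [h])
    · exact hS.star_mul_of_ne_block i j hij k m
  obtain ⟨w, hwC, hwt, hwe⟩ := exists_isColumnSystem_lift hC (c := fun k : K => k.1)
    hS.isStarProjection h1 h2
  have hv : IsColumnSystem (fun k : K => k.1) vK :=
    ⟨fun k m h => by rw [h1, h1]; exact congrArg P h, h2, fun k => by
      rw [h1]; exact mul_eq_self_of_star_mul_self_eq (hS.isStarProjection _) (h1 k)⟩
  have inr_sys : ∀ {a : K → A}, IsColumnSystem (fun k : K => k.1) a →
      IsColumnSystem (fun k : K => k.1) fun k => (a k : Unitization ℂ A) := fun {a} ha => by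
    constructor
    · intro k m h
      rw [← Unitization.inr_star, ← Unitization.inr_mul, ha.star_mul_self k m h,
        Unitization.inr_mul, Unitization.inr_star]
    · intro k m h
      rw [← Unitization.inr_star, ← Unitization.inr_mul, ha.star_mul_of_ne k m h,
        Unitization.inr_zero]
    · intro k
      rw [← Unitization.inr_star, ← Unitization.inr_mul, ← Unitization.inr_mul, ha.mul_star_mul]
  have hinr : Continuous fun a : A => (a : Unitization ℂ A) :=
    (AddMonoidHomClass.isometry_of_norm (Unitization.inrHom ℂ ℂ A)
      Unitization.norm_inr).continuous
  let W : ι → Unitization ℂ A := fun i =>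
    ∑ k, (w k i : Unitization ℂ A) * star (vK k : Unitization ℂ A) +
      (1 - ∑ k, (w k i : Unitization ℂ A) * star (w k i : Unitization ℂ A)) *
        (1 - ∑ k, (vK k : Unitization ℂ A) * star (vK k : Unitization ℂ A))
  have hW : Tendsto W l (𝓝 1) := by
    set z : Unitization ℂ A := ∑ k, (vK k : Unitization ℂ A) * star (vK k : Unitization ℂ A)
      with hz
    have hwt' : ∀ k, Tendsto (fun i => (w k i : Unitization ℂ A)) l (𝓝 (vK k)) := fun k =>
      (hinr.tendsto _).comp (hwt k)
    have t1 : Tendsto (fun i => ∑ k, (w k i : Unitization ℂ A) * star (vK k : Unitization ℂ A)) l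
        (𝓝 z) := tendsto_finsetSum _ fun k _ => (hwt' k).mul_const _
    have t2 : Tendsto (fun i => ∑ k, (w k i : Unitization ℂ A) * star (w k i : Unitization ℂ A)) l
        (𝓝 z) := tendsto_finsetSum _ fun k _ => (hwt' k).mul (hwt' k).star
    have t3 := t1.add ((t2.const_sub 1).mul_const (1 - z))
    have hzz : z * z = z := by
      have hv' := inr_sys hv
      rw [hz, Finset.mul_sum]
      refine Finset.sum_congr rfl fun k _ => ?_
      rw [← mul_assoc, Finset.sum_mul, Finset.sum_eq_single k, mul_assoc (vK k : Unitization ℂ A),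
        hv'.mul_star_mul]
      · intro m _ hm
        rw [mul_assoc, hv'.star_mul_of_ne m k hm, mul_zero]
      · simp
    -- The complementary summand in `W` is there to make the limit the unit, rather than just the
    -- support projection `z` of `B`.
    have e : z + (1 - z) * (1 - z) = 1 := by
      calc z + (1 - z) * (1 - z) = 1 - z + z * z := by noncomm_ring
        _ = 1 := by rw [hzz]; abel
    rwa [e] at t3
  obtain ⟨Φ, hΦ, hΦe⟩ := exists_polar_unitary (Unitization ℂ A)
  have hu := hΦ.comp hW
  choose d hdC hd using hC
  have hev : ∀ᶠ i in l, ∀ b ∈ S,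
      ‖(b : Unitization ℂ A) - star (Φ (W i)) * (d b i : Unitization ℂ A) * Φ (W i)‖ < ε := by
    rw [Filter.eventually_all_finset]
    intro b _
    have t : Tendsto (fun i => star (Φ (W i)) * (d b i : Unitization ℂ A) * Φ (W i)) l
        (𝓝 (b : Unitization ℂ A)) := by
      have := (hu.star.mul ((hinr.tendsto _).comp (hd b))).mul hu
      simpa using this
    have t' := (tendsto_const_nhds (x := (b : Unitization ℂ A))).sub t |>.norm
    rw [sub_self, norm_zero] at t'
    exact t'.eventually_lt_const hε
  obtain ⟨i, ⟨hwi, hWi⟩, happ⟩ := ((hwe.and (hW.eventually hΦe)).and hev).exists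
  obtain ⟨huU, hint⟩ := hWi
  set u := Φ (W i) with hudef
  let D : NonUnitalStarSubalgebra ℂ (Unitization ℂ A) :=
    (C i).map (Unitization.inrNonUnitalStarAlgHom ℂ A)
  -- This is `u⋆ C_i u`. It contains `B` because `u` carries each matrix unit `v_k v_m⋆` to `w_k
  -- w_m⋆ ∈ C_i`.
  let B' : NonUnitalStarSubalgebra ℂ A := D.comap (conjUnitization u huU)
  have hmem : ∀ a, a ∈ B' ↔ ∃ x ∈ C i, (x : Unitization ℂ A) = u * a * star u := fun a =>
    Iff.rfl
  refine ⟨B', fun x hx => ?_, ?_, fun b hb => ?_⟩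
  · have hle : Submodule.span ℂ {y | ∃ j k l, y = v j k * star (v j l)} ≤ B'.toSubmodule := by
      rw [Submodule.span_le]
      rintro _ ⟨j, k, m, rfl⟩
      refine (hmem _).mpr ⟨w ⟨j, k⟩ i * star (w ⟨j, m⟩ i),
        mul_mem (hwC _ i) (star_mem (hwC _ i)), ?_⟩
      have e1 := (inr_sys hv).intertwine (inr_sys hwi) (k := ⟨j, k⟩) (m := ⟨j, m⟩) rfl
      have e2 := (inr_sys hv).intertwine (inr_sys hwi) (k := ⟨j, m⟩) (m := ⟨j, k⟩) rfl
      have e3 := hint _ _ e1 (by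
        rw [star_mul, star_star, star_mul, star_star]; exact e2)
      simp only [Unitization.inr_mul, Unitization.inr_star]
      have e4 : u * ((v j k : Unitization ℂ A) * star (v j m : Unitization ℂ A)) =
        (w ⟨j, k⟩ i : Unitization ℂ A) * star (w ⟨j, m⟩ i : Unitization ℂ A) * u := e3
      rw [e4, mul_assoc, Unitary.mul_star_self_of_mem huU, mul_one]
    exact hle (hS.mem_span x hx)
  · have hCi : FiniteDimensional ℂ (C i).toSubmodule := hCf i
    have hDf : FiniteDimensional ℂ D.toSubmodule :=
      inferInstanceAs (FiniteDimensional ℂ ((C i).toSubmodule.map (Unitization.inrHom ℂ ℂ A)))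
    let f : A →ₗ[ℂ] Unitization ℂ A :=
      { toFun := conjUnitization u huU
        map_add' := map_add _
        map_smul' := map_smul _ }
    let f' : B'.toSubmodule →ₗ[ℂ] D.toSubmodule := f.restrict fun x hx => hx
    exact Module.Finite.of_injective f' fun x y hxy =>
      Subtype.ext (conjUnitization_injective u huU (congrArg Subtype.val hxy))
  -- Conjugation by `u` stays in `A`, which is an ideal of the unitization.
  · obtain ⟨b', hb'⟩ : ∃ b' : A,
        (b' : Unitization ℂ A) = star u * (d b i : Unitization ℂ A) * u := by
      refine ⟨(star u * (d b i : Unitization ℂ A) * u).snd, ?_⟩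
      ext <;> simp
    refine ⟨b', (hmem _).mpr ⟨d b i, hdC b i, ?_⟩, ?_⟩
    · rw [hb']
      calc _ = 1 * (d b i : Unitization ℂ A) * 1 := by rw [one_mul, mul_one]
        _ = (u * star u) * (d b i : Unitization ℂ A) * (u * star u) := by
            rw [Unitary.mul_star_self_of_mem huU]
        _ = _ := by simp only [mul_assoc]
    · have := happ b hb
      rwa [← hb', ← Unitization.inr_sub, Unitization.norm_inr] at this

end Perturbation

/-! ### From local approximation to an increasing sequence -/

open Filter in
open scoped Topology in
/-- A separable C⋆-algebra which is locally approximated by finite-dimensional subalgebras is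
an AF algebra. -/
theorem IsAFAlgebra.of_forall_exists_approx {A : Type*} [NonUnitalCStarAlgebra A]
    [PartialOrder A] [StarOrderedRing A] [SeparableSpace A]
    (h : ∀ (S : Finset A) (ε : ℝ), 0 < ε → ∃ C : NonUnitalStarSubalgebra ℂ A,
      FiniteDimensional ℂ C ∧ ∀ b ∈ S, ∃ c ∈ C, ‖b - c‖ < ε) :
    IsAFAlgebra A := by
  classical
  choose C hCfin c hcC hc using fun i : Finset A × ℕ =>
    h i.1 (1 / ((i.2 : ℝ) + 1)) Nat.one_div_pos_of_nat
  -- Indexing by finite sets and tolerances turns local approximation into convergence along one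
  -- directed family of subalgebras.
  have hC : ∀ a, ∃ c : Finset A × ℕ → A, (∀ i, c i ∈ C i) ∧ Tendsto c atTop (𝓝 a) := by
    intro a
    refine ⟨fun i => if ha : a ∈ i.1 then c i a ha else 0, fun i => ?_, ?_⟩
    · dsimp only
      split_ifs with ha
      · exact hcC i a ha
      · exact zero_mem _
    · rw [tendsto_iff_norm_sub_tendsto_zero]
      have h1 : Tendsto (fun i : Finset A × ℕ => 1 / ((i.2 : ℝ) + 1)) atTop (𝓝 0) :=
        tendsto_one_div_add_atTop_nhds_zero_nat.comp
          (by rw [← prod_atTop_atTop_eq]; exact tendsto_snd)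
      refine squeeze_zero' (Eventually.of_forall fun _ => norm_nonneg _) ?_ h1
      filter_upwards [eventually_ge_atTop (({a} : Finset A), 0)] with i hi
      have ha : a ∈ i.1 := hi.1 (Finset.mem_singleton_self a)
      rw [dif_pos ha, norm_sub_rev]
      exact (hc i a ha).le
  have step : ∀ (n : ℕ) (B : {B : NonUnitalStarSubalgebra ℂ A // FiniteDimensional ℂ B}),
      ∃ B' : {B : NonUnitalStarSubalgebra ℂ A // FiniteDimensional ℂ B}, B.1 ≤ B'.1 ∧
        ∀ b ∈ (Finset.range n).image (denseSeq A), ∃ c ∈ B'.1, ‖b - c‖ < 1 / ((n : ℝ) + 1) := by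
    rintro n ⟨B, hB⟩
    obtain ⟨B', h1, h2, h3⟩ := exists_finiteDimensional_ge_approx hC B
      ((Finset.range n).image (denseSeq A)) (Nat.one_div_pos_of_nat (α := ℝ) (n := n))
    exact ⟨⟨B', h2⟩, h1, h3⟩
  choose next hle happrox using step
  let B : ℕ → {B : NonUnitalStarSubalgebra ℂ A // FiniteDimensional ℂ B} := fun n =>
    Nat.rec (next 0 ⟨C (∅, 0), hCfin _⟩) next n
  refine ⟨fun n => (B n).1, monotone_nat_of_le_succ fun n => hle n (B n), fun n => (B n).2, ?_⟩
  refine Metric.dense_iff.mpr fun x ε hε => ?_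
  obtain ⟨k, hk⟩ := (denseRange_denseSeq A).exists_dist_lt x (half_pos hε)
  obtain ⟨m, hm⟩ := exists_nat_one_div_lt (half_pos hε)
  -- Stage `n + 1` handles the dense points of index below `n`, so `k + 1 ≤ n` is needed; `m`
  -- controls the tolerance.
  let n := max (k + 1) m
  obtain ⟨y, hy, hxy⟩ := happrox n (B n) (denseSeq A k)
    (Finset.mem_image_of_mem _ (Finset.mem_range.mpr (le_max_left (k + 1) m)))
  refine ⟨y, ?_, Set.mem_iUnion.mpr ⟨n + 1, hy⟩⟩
  have h1 : 1 / ((n : ℝ) + 1) ≤ 1 / ((m : ℝ) + 1) := by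
    gcongr
    exact le_max_right _ _
  rw [← dist_eq_norm] at hxy
  rw [Metric.mem_ball, dist_comm]
  linarith [dist_triangle x (denseSeq A k) y]

/-! ### AF algebras: factorization through sums of matrix algebras -/

section MatrixFactorization

theorem MatrixSum.incl_mul {ι : Type*} (r : ι → ℕ) (p : ι → Prop) [DecidablePred p]
    (x y : MatrixSum fun i : {i // p i} => r i) :
    MatrixSum.incl r p (x * y) = MatrixSum.incl r p x * MatrixSum.incl r p y := by
  funext i
  by_cases h : p i <;> simp [MatrixSum.incl, h]

theorem MatrixSum.incl_star {ι : Type*} (r : ι → ℕ) (p : ι → Prop) [DecidablePred p]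
    (x : MatrixSum fun i : {i // p i} => r i) :
    MatrixSum.incl r p (star x) = star (MatrixSum.incl r p x) := by
  funext i
  by_cases h : p i <;> simp [MatrixSum.incl, h]

variable {A : Type*} [NonUnitalCStarAlgebra A]

/-- A norm-one functional attaining its norm at a projection is real on the self-adjoint part of
the corner. -/
theorem im_apply_eq_zero_of_norm_eq_one {P : A} (hP : IsStarProjection P)
    {g : A →L[ℂ] ℂ} (hg : ‖g‖ = 1) (hgP : g P = 1) {b : A} (hb : IsSelfAdjoint b)
    (hPb : P * b = b) : (g b).im = 0 := by
  have hbP : b * P = b := by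
    have := congrArg star hPb
    rwa [star_mul, hP.isSelfAdjoint.star_eq, hb.star_eq] at this
  have hnP : ‖P‖ ≤ 1 := hP.norm_le
  -- Compare `|g(b + i t P)|²` with `‖b + i t P‖² = ‖b⋆ b + t² P‖`. After cancelling `t²`, a term
  -- linear in `t` with coefficient `2 Im g(b)` stays bounded above.
  have key : ∀ t : ℝ, (g b).re ^ 2 + ((g b).im + t) ^ 2 ≤ ‖b‖ ^ 2 + t ^ 2 := fun t => by
    have h1 : ‖g (b + (t * Complex.I) • P)‖ ≤ ‖b + (t * Complex.I) • P‖ := by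
      simpa [hg] using g.le_opNorm (b + (t * Complex.I) • P)
    have h2 : ‖b + (t * Complex.I) • P‖ ^ 2 ≤ ‖b‖ ^ 2 + t ^ 2 := by
      rw [sq, ← CStarRing.norm_star_mul_self]
      have : star (b + (t * Complex.I) • P) * (b + (t * Complex.I) • P) =
          star b * b + ((t : ℂ) ^ 2) • P := by
        rw [star_add, star_smul, hb.star_eq, hP.isSelfAdjoint.star_eq, add_mul, mul_add, mul_add,
          mul_smul_comm, smul_mul_assoc, smul_mul_smul_comm, hPb, hbP, hP.isIdempotentElem.eq]
        have : star ((t : ℂ) * Complex.I) = -(t * Complex.I) := by simp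
        rw [this]
        have h3 : -(t * Complex.I) * ((t : ℂ) * Complex.I) = (t : ℂ) ^ 2 := by
          linear_combination -(t : ℂ) ^ 2 * Complex.I_sq
        rw [h3]
        module
      rw [this]
      refine (norm_add_le _ _).trans (add_le_add ?_ ?_)
      · rw [CStarRing.norm_star_mul_self, sq]
      · rw [norm_smul]
        calc _ ≤ ‖(t : ℂ) ^ 2‖ * 1 := by gcongr
          _ = t ^ 2 := by rw [mul_one, norm_pow, Complex.norm_real, Real.norm_eq_abs, sq_abs]
    have h4 : ‖g (b + (t * Complex.I) • P)‖ ^ 2 = (g b).re ^ 2 + ((g b).im + t) ^ 2 := by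
      rw [map_add, map_smul, hgP, smul_eq_mul, mul_one, Complex.sq_norm, Complex.normSq_apply]
      simp
      ring
    rw [← h4]
    exact (pow_le_pow_left₀ (norm_nonneg _) h1 2).trans h2
  by_contra h
  have h5 := key ((‖b‖ ^ 2 + 1) / (g b).im)
  have h6 : (g b).im * ((‖b‖ ^ 2 + 1) / (g b).im) = ‖b‖ ^ 2 + 1 := mul_div_cancel₀ _ h
  nlinarith [sq_nonneg (g b).re, sq_nonneg (g b).im, sq_nonneg ‖b‖]

theorem IsMatrixUnitSystem.reindex {B : NonUnitalStarSubalgebra ℂ A} {J J' : Type} {r : J → ℕ}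
    {v : ∀ j, Fin (r j) → A} {P : J → A} (h : IsMatrixUnitSystem B r v P) (e : J' ≃ J) :
    IsMatrixUnitSystem B (r ∘ e) (fun j => v (e j)) (P ∘ e) where
  pos j := h.pos _
  isStarProjection j := h.isStarProjection _
  ne_zero j := h.ne_zero _
  mem j := h.mem _
  star_mul_self j := h.star_mul_self _
  star_mul_of_ne j := h.star_mul_of_ne _
  star_mul_of_ne_block i j hij := h.star_mul_of_ne_block _ _ (e.injective.ne hij)
  mem_span x hx := by
    refine Submodule.span_mono ?_ (h.mem_span x hx)
    rintro _ ⟨j, k, l, rfl⟩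
    obtain ⟨j, rfl⟩ := e.surjective j
    exact ⟨j, k, l, rfl⟩

/-- The ⋆-homomorphism from a sum of matrix algebras determined by a system of matrix units. -/
noncomputable def IsMatrixUnitSystem.toStarAlgHom {B : NonUnitalStarSubalgebra ℂ A} {s : ℕ}
    {r : Fin s → ℕ} {v : ∀ j, Fin (r j) → A} {P : Fin s → A} (h : IsMatrixUnitSystem B r v P) :
    MatrixSum r →⋆ₙₐ[ℂ] A where
  toFun x := ∑ j, ∑ k, ∑ l, x j k l • (v j k * star (v j l))
  map_zero' := by simp
  map_add' x y := by simp [add_smul, Finset.sum_add_distrib]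
  map_smul' c x := by simp [Finset.smul_sum, smul_smul]
  map_star' x := by
    simp only [star_sum, star_smul, star_mul, star_star]
    refine Finset.sum_congr rfl fun j _ => ?_
    rw [Finset.sum_comm]
    rfl
  map_mul' x y := by
    classical
    have key : ∀ j m, (∑ i, ∑ k, ∑ l, x i k l • (v i k * star (v i l))) * v j m =
        ∑ k, x j k m • v j k := by
      intro j m
      simp only [Finset.sum_mul, smul_mul_assoc, mul_assoc]
      rw [Finset.sum_eq_single j]
      · refine Finset.sum_congr rfl fun k _ => ?_
        rw [Finset.sum_eq_single m]
        · rw [h.star_mul_self, mul_eq_self_of_star_mul_self_eq (h.isStarProjection j)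
            (h.star_mul_self j k)]
        · intro l _ hl
          rw [h.star_mul_of_ne j l m hl, mul_zero, smul_zero]
        · simp
      · intro i _ hi
        simp [h.star_mul_of_ne_block i j hi]
      · simp
    symm
    rw [Finset.mul_sum]
    refine Finset.sum_congr rfl fun j _ => ?_
    simp only [Finset.mul_sum, mul_smul_comm, ← mul_assoc, key, Finset.sum_mul, smul_mul_assoc,
      Finset.smul_sum, smul_smul]
    rw [Finset.sum_comm_cycle]
    refine Finset.sum_congr rfl fun k _ => ?_
    rw [Finset.sum_comm]
    refine Finset.sum_congr rfl fun l _ => ?_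
    rw [← Finset.sum_smul, Pi.mul_apply, CStarMatrix.mul_apply]
    simp only [mul_comm]

variable [PartialOrder A]

/-- The compression `a ↦ (ω j (v j k⋆ a v j l))` to a sum of matrix algebras. -/
noncomputable def matrixCompression {s : ℕ} {r : Fin s → ℕ} (v : ∀ j, Fin (r j) → A)
    (ω : Fin s → A →ₚ[ℂ] ℂ) : A →ₗ[ℂ] MatrixSum r where
  toFun a j := CStarMatrix.ofMatrix fun k l => ω j (star (v j k) * (a * v j l))
  map_add' a b := by
    funext j
    ext k l
    change ω j (star (v j k) * ((a + b) * v j l)) =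
      ω j (star (v j k) * (a * v j l)) + ω j (star (v j k) * (b * v j l))
    rw [add_mul, mul_add, map_add]
  map_smul' c a := by
    funext j
    ext k l
    change ω j (star (v j k) * (c • a * v j l)) = c * ω j (star (v j k) * (a * v j l))
    rw [smul_mul_assoc, mul_smul_comm, map_smul, smul_eq_mul]

/-- On a matrix unit, `v_k⋆ (v_m v_n⋆) v_l` is `P` for `k = m`, `l = n` and zero otherwise, so `ω`
reads off its coordinates. -/
theorem IsMatrixUnitSystem.toStarAlgHom_matrixCompression {B : NonUnitalStarSubalgebra ℂ A} {s : ℕ}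
    {r : Fin s → ℕ} {v : ∀ j, Fin (r j) → A} {P : Fin s → A} (h : IsMatrixUnitSystem B r v P)
    {ω : Fin s → A →ₚ[ℂ] ℂ} (hω : ∀ j, ω j (P j) = 1) {b : A} (hb : b ∈ B) :
    h.toStarAlgHom (matrixCompression v ω b) = b := by
  classical
  refine LinearMap.eqOn_span (f := (h.toStarAlgHom : MatrixSum r →ₗ[ℂ] A) ∘ₗ
    matrixCompression v ω) (g := LinearMap.id) ?_ (h.mem_span b hb)
  rintro _ ⟨j, m, n, rfl⟩
  change ∑ i, ∑ k, ∑ l, ω i (star (v i k) * (v j m * star (v j n) * v i l)) •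
    (v i k * star (v i l)) = v j m * star (v j n)
  rw [Finset.sum_eq_single j, Finset.sum_eq_single m, Finset.sum_eq_single n]
  · rw [mul_assoc, h.star_mul_self, ← mul_assoc, mul_assoc, mul_eq_self_of_star_mul_self_eq
      (h.isStarProjection j) (h.star_mul_self j m), h.star_mul_self, hω, one_smul]
  · intro l _ hl
    rw [mul_assoc (v j m), h.star_mul_of_ne j n l hl.symm, mul_zero, mul_zero, map_zero, zero_smul]
  · simp
  · intro k _ hk
    simp [← mul_assoc, h.star_mul_of_ne j k m hk]
  · simp
  · intro i _ hi
    simp [← mul_assoc, h.star_mul_of_ne_block i j hi]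
  · simp

variable [StarOrderedRing A]

/-- Every nonzero projection is normalized by some positive functional. -/
theorem exists_positiveLinearMap_apply_eq_one {P : A} (hP : IsStarProjection P) (hP0 : P ≠ 0) :
    ∃ ω : A →ₚ[ℂ] ℂ, ω P = 1 := by
  have hn : ‖P‖ = 1 := by
    have h := CStarRing.norm_star_mul_self (x := P)
    rw [hP.isSelfAdjoint.star_eq, hP.isIdempotentElem.eq] at h
    exact (mul_right_cancel₀ (norm_ne_zero_iff.mpr hP0) ((one_mul _).trans h)).symm
  obtain ⟨g, hg, hgP⟩ := exists_dual_vector ℂ P (by rw [hn]; exact one_ne_zero)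
  have hgP : g P = 1 := by rw [hgP, hn]; norm_num
  have hPs := hP.isSelfAdjoint.star_eq
  have hPP := hP.isIdempotentElem.eq
  refine ⟨PositiveLinearMap.mk₀ (g.toLinearMap ∘ₗ LinearMap.mulLeft ℂ P ∘ₗ
    LinearMap.mulRight ℂ P) fun a ha => ?_, ?_⟩
  · change 0 ≤ g (P * (a * P))
    rw [← mul_assoc]
    set b := P * a * P with hb
    have hb0 : 0 ≤ b := by simpa [hPs] using star_left_conjugate_nonneg ha P
    have him : (g b).im = 0 := im_apply_eq_zero_of_norm_eq_one hP hg hgP (.of_nonneg hb0)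
      (by rw [hb, ← mul_assoc, ← mul_assoc, hPP])
    -- From `0 ≤ b ≤ ‖a‖ P` one gets `‖‖a‖ P - b‖ ≤ ‖a‖`; so `g b` lies within `‖a‖` of `‖a‖` and
    -- has nonnegative real part.
    have h1 : b ≤ ‖a‖ • P := by
      simpa only [hPs, hPP] using
        CStarAlgebra.star_left_conjugate_le_norm_smul (a := P) (.of_nonneg ha)
    have h2 : ‖‖a‖ • P - b‖ ≤ ‖a‖ := by
      refine (CStarAlgebra.norm_le_norm_of_nonneg_of_le (sub_nonneg.mpr h1)
        (sub_le_self _ hb0)).trans ?_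
      rw [norm_smul, hn, norm_norm, mul_one]
    have h3 : ‖g (‖a‖ • P - b)‖ ≤ ‖a‖ := by
      exact (g.le_opNorm _).trans (by rw [hg, one_mul]; exact h2)
    have h4 : g (‖a‖ • P - b) = ‖a‖ - g b := by
      rw [map_sub, ← Complex.coe_smul, map_smul, hgP, smul_eq_mul, mul_one]
    have h5 := (Complex.abs_re_le_norm _).trans h3
    rw [h4, Complex.sub_re, Complex.ofReal_re] at h5
    rw [Complex.nonneg_iff]
    exact ⟨by linarith [(abs_le.mp h5).2], him.symm⟩
  · change g (P * (P * P)) = 1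
    rw [hPP, hPP, hgP]

open scoped MatrixOrder in
-- A sum of Gram matrices is positive semidefinite, hence of the form `R⋆ R`.
theorem exists_conjTranspose_mul_self_eq_gram {E n τ : Type*} [SeminormedAddCommGroup E]
    [InnerProductSpace ℂ E] [Fintype n] [Fintype τ] (x : τ → n → E) :
    ∃ R : Matrix n n ℂ, ∀ p q, ∑ t, inner ℂ (x t p) (x t q) = ∑ m, star (R m p) * R m q := by
  classical
  have h : (∑ t, Matrix.gram ℂ (x t)).PosSemidef :=
    Matrix.posSemidef_sum _ fun t _ => Matrix.posSemidef_gram ℂ (x t)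
  obtain ⟨R, hR⟩ := CStarAlgebra.nonneg_iff_eq_star_mul_self.mp h.nonneg
  refine ⟨R, fun p q => ?_⟩
  have := congrFun₂ hR p q
  simpa [Matrix.sum_apply, Matrix.mul_apply] using this

/-- Complete positivity of the compression. For `M = N⋆ N`, the `j`-th component of the image is a
sum of Gram matrices of the vectors `N_tp v_ja` in the GNS space of `ω j`. Factoring each as `R⋆ R`
and regrouping indices displays the image as `X⋆ X`. -/
theorem matrixCompression_map_nonneg {s : ℕ} {r : Fin s → ℕ} (v : ∀ j, Fin (r j) → A)
    (ω : Fin s → A →ₚ[ℂ] ℂ) (k : ℕ) (M : CStarMatrix (Fin k) (Fin k) A) (hM : 0 ≤ M) :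
    0 ≤ M.map (matrixCompression v ω) := by
  obtain ⟨N, rfl⟩ := exists_star_mul_self_of_nonneg hM
  choose R hR using fun j => exists_conjTranspose_mul_self_eq_gram
    (fun (t : Fin k) (p : Fin k × Fin (r j)) => (ω j).toPreGNS (N t p.1 * v j p.2))
  let X : CStarMatrix (Fin k) (Fin k) (MatrixSum r) := CStarMatrix.ofMatrix fun t p j =>
    CStarMatrix.ofMatrix fun c a => R j (t, c) (p, a)
  have : (star N * N).map (matrixCompression v ω) = star X * X := by
    ext p q j a b
    have h := hR j (p, a) (q, b)
    simp only [PositiveLinearMap.preGNS_inner_def, PositiveLinearMap.ofPreGNS_toPreGNS] at h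
    have h1 : (star X * X) p q j a b = ∑ t, ∑ c, star (R j (t, c) (p, a)) * R j (t, c) (q, b) := by
      have h2 : ∀ t, (star X p t * X t q) j a b =
          ∑ c, star (R j (t, c) (p, a)) * R j (t, c) (q, b) := fun t => by
        rw [Pi.mul_apply, CStarMatrix.mul_apply]
        rfl
      simp only [← h2]
      rw [CStarMatrix.mul_apply, Finset.sum_apply]
      exact Matrix.sum_apply a b _ fun c => (star X p c * X c q) j
    rw [h1, ← Fintype.sum_prod_type', ← h, ← map_sum]
    change ω j (star (v j a) * ((∑ t, star (N t p) * N t q) * v j b)) = _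
    simp only [star_mul, mul_assoc, Finset.sum_mul, Finset.mul_sum]
  rw [this]
  exact star_mul_self_nonneg X

theorem CStarMatrix.norm_le_of_forall_sum_le {n : Type*} [Fintype n] {M : CStarMatrix n n ℂ}
    {C : ℝ} (hC : 0 ≤ C) (h : ∀ v w : n → ℂ, ‖∑ k, ∑ l, v k * M k l * star (w l)‖ ≤
      C * √(∑ k, ‖v k‖ ^ 2) * √(∑ k, ‖w k‖ ^ 2)) : ‖M‖ ≤ C := by
  lift C to NNReal using hC
  have hn : ∀ v : WithCStarModule ℂ (n → ℂ), ‖v‖ = √(∑ k, ‖v k‖ ^ 2) := fun v => by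
    rw [WithCStarModule.pi_norm]
    congr 1
    simp only [WithCStarModule.inner_def]
    have : ∑ i, v i * star (v i) = ((∑ i, ‖v i‖ ^ 2 : ℝ) : ℂ) := by
      push_cast
      exact Finset.sum_congr rfl fun i _ => RCLike.mul_conj (v i)
    rw [this, Complex.norm_real, Real.norm_of_nonneg (by positivity)]
  refine CStarMatrix.norm_le_of_forall_inner_le fun v w => ?_
  rw [hn, hn]
  refine le_trans (le_of_eq ?_) (h v w)
  rw [CStarMatrix.toCLM_apply_eq_sum, WithCStarModule.pi_inner]
  congr 1
  rw [Finset.sum_comm]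
  refine Finset.sum_congr rfl fun l _ => ?_
  rw [← Finset.sum_mul]
  rfl

/-- The hypothesis makes the `v j k` orthonormal in the GNS space of `ω j`, so each block is a
compression of left multiplication by `a`, whose norm is at most `‖a‖`. -/
theorem norm_matrixCompression_le {s : ℕ} {r : Fin s → ℕ} {v : ∀ j, Fin (r j) → A}
    {ω : Fin s → A →ₚ[ℂ] ℂ} (h : ∀ j k l, ω j (star (v j k) * v j l) = if k = l then 1 else 0)
    (a : A) : ‖matrixCompression v ω a‖ ≤ ‖a‖ := by
  refine (pi_norm_le_iff_of_nonneg (norm_nonneg a)).mpr fun j => ?_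
  refine CStarMatrix.norm_le_of_forall_sum_le (norm_nonneg a) fun x y => ?_
  let V : (Fin (r j) → ℂ) → (ω j).PreGNS := fun x => (ω j).toPreGNS (∑ k, star (x k) • v j k)
  have hV : ∀ x, ‖V x‖ = √(∑ k, ‖x k‖ ^ 2) := fun x => by
    rw [PositiveLinearMap.preGNS_norm_def, PositiveLinearMap.ofPreGNS_toPreGNS]
    congr 1
    simp only [star_sum, star_smul, star_star, Finset.sum_mul, Finset.mul_sum, smul_mul_assoc,
      mul_smul_comm, map_sum, map_smul, h, smul_eq_mul, mul_ite, mul_one, mul_zero,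
      Finset.sum_ite_eq', Finset.mem_univ, if_true]
    have : ∑ k, star (x k) * x k = ((∑ k, ‖x k‖ ^ 2 : ℝ) : ℂ) := by
      push_cast
      exact Finset.sum_congr rfl fun i _ => RCLike.conj_mul (x i)
    rw [this, Complex.ofReal_re]
  have e : ∑ k, ∑ l, x k * matrixCompression v ω a j k l * star (y l) =
      inner ℂ (V x) ((ω j).leftMulMapPreGNS a (V y)) := by
    rw [PositiveLinearMap.preGNS_inner_def]
    change _ = ω j (star (∑ k, star (x k) • v j k) * (a * ∑ l, star (y l) • v j l))
    simp only [star_sum, star_smul, star_star, Finset.sum_mul, Finset.mul_sum, smul_mul_assoc,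
      mul_smul_comm, map_sum, map_smul, smul_eq_mul]
    rw [Finset.sum_comm]
    refine Finset.sum_congr rfl fun l _ => Finset.sum_congr rfl fun k _ => ?_
    change x k * ω j (star (v j k) * (a * v j l)) * star (y l) = _
    ring
  rw [e, ← hV, ← hV]
  calc _ ≤ ‖V x‖ * ‖(ω j).leftMulMapPreGNS a (V y)‖ := norm_inner_le_norm _ _
    _ ≤ ‖V x‖ * (‖a‖ * ‖V y‖) := by
      gcongr
      exact ContinuousLinearMap.le_of_opNorm_le _
        (LinearMap.mkContinuous_norm_le _ (norm_nonneg a) _) _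
    _ = _ := by ring

/-- An AF algebra has decomposition rank zero. -/
theorem IsAFAlgebra.hasDecompositionRankLE_zero (h : IsAFAlgebra A) :
    HasDecompositionRankLE A 0 := by
  classical
  obtain ⟨B, hB, hfin, hd⟩ := h
  intro S ε hε
  have hS : ∀ b ∈ S, ∃ n, ∃ c ∈ B n, ‖b - c‖ < ε / 2 := fun b _ => by
    obtain ⟨c, hbc, hc⟩ := Metric.dense_iff.mp hd b (ε / 2) (half_pos hε)
    obtain ⟨n, hn⟩ := Set.mem_iUnion.mp hc
    exact ⟨n, c, hn, by rwa [← dist_eq_norm, dist_comm]⟩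
  choose! n c hc hbc using hS
  -- Monotonicity puts all the chosen approximants in the single subalgebra `B m`.
  let m := S.sup n
  have := hfin m
  obtain ⟨J, hJ, r', v', P', hU'⟩ := exists_isMatrixUnitSystem (B m)
  obtain ⟨s, r, v, P, hU⟩ : ∃ (s : ℕ) (r : Fin s → ℕ) (v : ∀ j, Fin (r j) → A) (P : Fin s → A),
    IsMatrixUnitSystem (B m) r v P := ⟨_, _, _, _, hU'.reindex (Fintype.equivFin J).symm⟩
  choose ω hω using fun j => exists_positiveLinearMap_apply_eq_one (hU.isStarProjection j)
    (hU.ne_zero j)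
  let ψ : A →CP MatrixSum r :=
    ⟨matrixCompression v ω, matrixCompression_map_nonneg v ω⟩
  let φ : MatrixSum r →CP A :=
    CompletelyPositiveMapClass.toCompletelyPositiveLinearMap hU.toStarAlgHom
  have hφ : ∀ x, φ x = hU.toStarAlgHom x := fun _ => rfl
  have hψn : ∀ a, ‖ψ a‖ ≤ ‖a‖ := fun a => by
    refine norm_matrixCompression_le (fun j k l => ?_) a
    split_ifs with hkl
    · rw [hkl, hU.star_mul_self, hω]
    · rw [hU.star_mul_of_ne j k l hkl, map_zero]
  have hφn : ∀ x, ‖φ x‖ ≤ ‖x‖ := NonUnitalStarAlgHom.norm_apply_le hU.toStarAlgHom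
  refine ⟨_, _, ψ, φ, hU.pos, hψn, hφn, fun b hb => ?_, fun _ => 0, fun j => ?_⟩
  · have h1 : φ (ψ (c b)) = c b := hU.toStarAlgHom_matrixCompression hω
      (hB (Finset.le_sup hb) (hc b hb))
    have h2 : φ (ψ b) - b = φ (ψ (b - c b)) - (b - c b) := by
      rw [map_sub, map_sub, h1]
      abel
    rw [h2]
    linarith [norm_sub_le (φ (ψ (b - c b))) (b - c b), hφn (ψ (b - c b)), hψn (b - c b), hbc b hb]
  -- A ⋆-homomorphism preserves orthogonality of arbitrary elements, so minimality plays no role;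
  -- the constant colouring uses the only colour.
  · rw [strictOrder_eq_zero_iff]
    intro e _ he
    obtain ⟨h1, h2, h3, h4⟩ := he 0 1 (by decide)
    have key : ∀ x y, x * y = 0 → hU.toStarAlgHom (MatrixSum.incl r (fun _ => 0 = j) x) *
        hU.toStarAlgHom (MatrixSum.incl r (fun _ => 0 = j) y) = 0 := fun x y hxy => by
      rw [← map_mul, ← MatrixSum.incl_mul, hxy, map_zero, map_zero]
    refine ⟨0, 1, by decide, key _ _ h1, key _ _ h2, ?_, ?_⟩
    · change star (hU.toStarAlgHom (MatrixSum.incl r _ (e 0))) * _ = 0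
      rw [← map_star, ← MatrixSum.incl_star]
      exact key _ _ h3
    · change _ * star (hU.toStarAlgHom (MatrixSum.incl r _ (e 1))) = 0
      rw [← map_star, ← MatrixSum.incl_star]
      exact key _ _ h4

end MatrixFactorization

theorem mainTheorem12 (A : Type*) [NonUnitalCStarAlgebra A] [PartialOrder A] [StarOrderedRing A]
    [SeparableSpace A] : decompositionRank A = 0 ↔ IsAFAlgebra A :=
  decompositionRank_eq_zero_iff.trans
    ⟨fun h => .of_forall_exists_approx fun S _ hε => h.exists_finiteDimensional_approx S hε,
      fun h => h.hasDecompositionRankLE_zero⟩
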